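/- Let $\mu$ be the measure on the closed half-plane $\Omega=\{z\in\mathbb{C}:\operatorname{Re} z\ge -\tfrac12\}$ given by $$d\mu=\sum_{n=-1}^{\infty}\frac{\left|\Gamma\left(\frac n2+iy+1\right)\right|^2}{2\pi\,(n+1)!}\,dy\,d\delta_{n/2}(x)\qquad(z=x+iy),$$ let $H^2(\mu)$ be the closed linear span of $\{a^z:0<a\le 1\}$ in $L^2(\mu)$, and let $P_\mu$ be the orthogonal projection of $L^2(\mu)$ onto $H^2(\mu)$. For $f\in L^\infty(\mu)$ let $T_f:H^2(\mu)\to H^2(\mu)$ be the operator $T_fh=P_\mu(fh)$. Let $\mathcal N$ be the Newton space: the Hilbert space of analytic functions on $\{z:\operatorname{Re} z>-\tfrac12\}$ that has the Newton polynomials $N_0(z)=1$, $N_n(z)=(-1)^n\frac{z(z-1)\cdots(z-(n-1))}{n!}$ $(n\ge1)$ as an orthonormal basis. For $\operatorname{Re} w>-\tfrac12$ let $K_w\in\mathcal N$ be the reproducing kernel function, $\langle f,K_w\rangle_{\mathcal N}=f(w)$ for all $f\in\mathcal N$, and let $k_w=K_w/\|K_w\|_{\mathcal N}$. Let $0<s,t<1$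 and let $w\in\mathbb{C}$ with $\operatorname{Re} w>-\tfrac12$. Then the function $k_w$, extended to the line $\operatorname{Re} z=-\tfrac12$ by its non-tangential limits (which exist $\mu$-almost everywhere on that line), defines a unique element of $H^2(\mu)$, again denoted by $k_w$, and $$\left\langle T_{t^z}^*\,T_{s^z}\,k_w,\;k_w\right\rangle_{H^2(\mu)}=\frac{s^{w}\,t^{\overline w}}{(s+t-st)^{2\operatorname{Re} w+1}},$$ where the inner product is linear in its first argument. -/

import Mathlib

open MeasureTheory Filter Topology Set
open scoped ENNReal InnerProductSpace ComplexConjugate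

noncomputable section

namespace Newton

/-! ### The measure `μ` and the space `H²(μ)` -/

/-- The point `x + i y` with `x = (n - 1) / 2`; as `n` runs through `0, 1, 2, …` the abscissa runs
through `-1/2, 0, 1/2, …`. -/
def linePoint (n : ℕ) (y : ℝ) : ℂ := (((n : ℝ) - 1) / 2 : ℝ) + y * Complex.I

/-- The density `|Γ(x + i y + 1)|² / (2 π n!)` on the line with abscissa `x = (n - 1) / 2`. -/
def lineDensity (n : ℕ) (y : ℝ) : ℝ :=
  ‖Complex.Gamma (linePoint n y + 1)‖ ^ 2 / (2 * Real.pi * (n.factorial : ℝ))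

/-- The measure `μ`, carried by the lines `Re z = (n - 1) / 2`, `n = 0, 1, 2, …`, of the closed
half-plane `Re z ≥ -1/2`. It is taken as a measure on `ℂ` that vanishes off this half-plane. -/
def mu : Measure ℂ :=
  Measure.sum fun n : ℕ =>
    ((volume : Measure ℝ).withDensity fun y => ENNReal.ofReal (lineDensity n y)).map (linePoint n)

/-- `H²(μ)`: the closed linear span in `L²(μ)` of the functions `z ↦ a ^ z`, `0 < a ≤ 1`. -/
def H2 : Submodule ℂ (Lp ℂ 2 mu) :=
  (Submodule.span ℂ
    {f : Lp ℂ 2 mu | ∃ a : ℝ, 0 < a ∧ a ≤ 1 ∧ f =ᵐ[mu] fun z : ℂ => (a : ℂ) ^ z}).topologicalClosure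

instance instCompleteSpaceH2 : CompleteSpace H2 :=
  (Submodule.isClosed_topologicalClosure _).completeSpace_coe

/-- The multiplication operator `M_φ` on `L²(μ)` for `φ ∈ L^∞(μ)`. -/
def mulOp (φ : Lp ℂ ∞ mu) : Lp ℂ 2 mu →L[ℂ] Lp ℂ 2 mu :=
  (ContinuousLinearMap.mul ℂ ℂ).holderL mu ∞ 2 2 φ

/-- The Toeplitz-like operator `T_φ h = P (φ h)` on `H²(μ)`, where `P` is the orthogonal projection
of `L²(μ)` onto `H²(μ)`. -/
def toeplitz (φ : Lp ℂ ∞ mu) : H2 →L[ℂ] H2 :=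
  H2.orthogonalProjectionOnto ∘L mulOp φ ∘L H2.subtypeL

theorem continuous_linePoint (n : ℕ) : Continuous (linePoint n) := by
  unfold linePoint
  fun_prop

theorem ae_mu_re : ∀ᵐ z ∂mu, -(1 / 2 : ℝ) ≤ z.re := by
  rw [mu, Measure.ae_sum_iff]
  intro n
  rw [ae_map_iff (continuous_linePoint n).measurable.aemeasurable
    (measurableSet_le measurable_const Complex.measurable_re)]
  refine Eventually.of_forall fun y => ?_
  have : (0 : ℝ) ≤ n := n.cast_nonneg
  simp [linePoint]
  linarith

theorem memLp_top_cpow {s : ℝ} (hs : s ∈ Ioo (0 : ℝ) 1) :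
    MemLp (fun z : ℂ => (s : ℂ) ^ z) ∞ mu := by
  refine memLp_top_of_bound (C := s ^ (-(1 / 2 : ℝ))) ?_ ?_
  · have h0 : (s : ℂ) ≠ 0 := by exact_mod_cast hs.1.ne'
    exact (continuous_id.const_cpow (Or.inl h0)).aestronglyMeasurable
  · filter_upwards [ae_mu_re] with z hz
    rw [Complex.norm_cpow_eq_rpow_re_of_pos hs.1]
    exact Real.rpow_le_rpow_of_exponent_ge hs.1 hs.2.le hz

/-- The function `z ↦ s ^ z`, `0 < s < 1`, as an element of `L^∞(μ)`. -/
def powSymbol (s : ℝ) (hs : s ∈ Ioo (0 : ℝ) 1) : Lp ℂ ∞ mu := (memLp_top_cpow hs).toLp _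

/-! ### The Newton space -/

/-- The open half-plane `Re z > -1/2`. -/
abbrev HalfPlane : Type := {z : ℂ // -(1 / 2 : ℝ) < z.re}

/-- The Newton polynomials `N_n(z) = (-1)^n z (z - 1) ⋯ (z - (n - 1)) / n!`. -/
def newtonPoly (n : ℕ) (z : ℂ) : ℂ :=
  (-1) ^ n * (∏ j ∈ Finset.range n, (z - j)) / (n.factorial : ℂ)

theorem newtonPoly_succ (n : ℕ) (z : ℂ) :
    newtonPoly (n + 1) z = newtonPoly n z * ((n - z) / (n + 1)) := by
  have h1 : (n.factorial : ℂ) ≠ 0 := by exact_mod_cast n.factorial_ne_zero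
  have h2 : (n + 1 : ℂ) ≠ 0 := by exact_mod_cast n.succ_ne_zero
  simp only [newtonPoly, Finset.prod_range_succ, Nat.factorial_succ]
  push_cast
  field_simp
  ring

theorem summable_normSq_newtonPoly {z : ℂ} (hz : -(1 / 2 : ℝ) < z.re) :
    Summable fun n : ℕ => ‖newtonPoly n z‖ ^ 2 := by
  set a : ℕ → ℝ := fun n => ‖newtonPoly n z‖ ^ 2 with ha
  have ha0 : ∀ n, 0 ≤ a n := fun n => by positivity
  have hrec : ∀ n : ℕ, (n + 1 : ℝ) * (n * a n - (n + 1) * a (n + 1)) =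
      a n * (n * (1 + 2 * z.re) - ‖z‖ ^ 2) := by
    intro n
    have h1 : a (n + 1) = a n * (((n - z.re) ^ 2 + z.im ^ 2) / (n + 1) ^ 2) := by
      simp only [ha, newtonPoly_succ, norm_mul, norm_div, mul_pow, div_pow]
      congr 2
      · rw [← Complex.normSq_eq_norm_sq, Complex.normSq_apply]
        simp; ring
      · have : ‖((n : ℂ) + 1)‖ = n + 1 := by
          have := Complex.norm_natCast (n + 1)
          push_cast at this
          exact this
        rw [this]
    have h2 : ‖z‖ ^ 2 = z.re ^ 2 + z.im ^ 2 := by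
      rw [← Complex.normSq_eq_norm_sq, Complex.normSq_apply]; ring
    rw [h1, h2]
    have : (n + 1 : ℝ) ≠ 0 := by positivity
    field_simp
    ring
  set c : ℝ := (1 + 2 * z.re) / 2 with hc
  have hc0 : 0 < c := by rw [hc]; linarith
  obtain ⟨m, hm⟩ := exists_nat_ge ((‖z‖ ^ 2 + c) / c)
  have hstep : ∀ n : ℕ, m ≤ n → c * a n ≤ n * a n - (n + 1) * a (n + 1) := by
    intro n hn
    have hn' : (‖z‖ ^ 2 + c) / c ≤ n := hm.trans (by exact_mod_cast hn)
    rw [div_le_iff₀ hc0] at hn'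
    have hp : (0 : ℝ) < n + 1 := by positivity
    refine le_of_mul_le_mul_left ?_ hp
    rw [hrec n]
    have h3 : (n + 1) * c ≤ n * (1 + 2 * z.re) - ‖z‖ ^ 2 := by
      have : 1 + 2 * z.re = 2 * c := by rw [hc]; ring
      rw [this]; linarith
    calc (n + 1 : ℝ) * (c * a n) = a n * ((n + 1) * c) := by ring
      _ ≤ _ := mul_le_mul_of_nonneg_left h3 (ha0 n)
  rw [← summable_nat_add_iff m]
  refine summable_of_sum_range_le (c := m * a m / c) (fun n => ha0 _) fun N => ?_
  rw [le_div_iff₀ hc0]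
  have hsum : c * ∑ i ∈ Finset.range N, a (i + m) ≤
      m * a m - ((N + m : ℕ) : ℝ) * a (N + m) := by
    induction N with
    | zero => simp
    | succ N ih =>
      rw [Finset.sum_range_succ, mul_add]
      have h4 := hstep (N + m) (by omega)
      have h5 : N + 1 + m = N + m + 1 := by omega
      rw [h5]
      push_cast at ih h4 ⊢
      linarith
  have : 0 ≤ ((N + m : ℕ) : ℝ) * a (N + m) := mul_nonneg (Nat.cast_nonneg _) (ha0 _)
  linarith

/-- The Newton space: its elements are given by their square-summable sequences of coefficients
`c n` and stand for the functions `∑ n, c n * N_n` on the half-plane `Re z > -1/2`; the inner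
product is that of `ℓ²`, so that the `N_n` are an orthonormal basis. -/
def NewtonSpace : Type := lp (fun _ : ℕ => ℂ) 2

instance : NormedAddCommGroup NewtonSpace :=
  inferInstanceAs (NormedAddCommGroup (lp (fun _ : ℕ => ℂ) 2))

instance : InnerProductSpace ℂ NewtonSpace :=
  inferInstanceAs (InnerProductSpace ℂ (lp (fun _ : ℕ => ℂ) 2))

instance : CompleteSpace NewtonSpace :=
  inferInstanceAs (CompleteSpace (lp (fun _ : ℕ => ℂ) 2))

/-- The coefficient sequence of an element of the Newton space. -/
def NewtonSpace.toLp (f : NewtonSpace) : lp (fun _ : ℕ => ℂ) 2 := f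

/-- The coefficients of an element of the Newton space. -/
def NewtonSpace.coeff (f : NewtonSpace) (n : ℕ) : ℂ := f.toLp n

theorem memlp_conj_newtonPoly (z : HalfPlane) :
    Memℓp (fun n : ℕ => conj (newtonPoly n z)) 2 := by
  refine memℓp_gen ?_
  simpa using summable_normSq_newtonPoly z.2

/-- The sequence `conj (N_n(z))` in `ℓ²`. -/
def conjNewton (z : HalfPlane) : NewtonSpace :=
  (⟨fun n : ℕ => conj (newtonPoly n z), memlp_conj_newtonPoly z⟩ : lp (fun _ : ℕ => ℂ) 2)

theorem hasSum_inner_conjNewton (z : HalfPlane) (f : NewtonSpace) :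
    HasSum (fun n : ℕ => f.coeff n * newtonPoly n z) (inner ℂ (conjNewton z) f) := by
  have h := lp.hasSum_inner (𝕜 := ℂ) (conjNewton z).toLp f.toLp
  have h1 : (fun n : ℕ => f.coeff n * newtonPoly n z) =
      fun n : ℕ => inner ℂ ((conjNewton z).toLp n) (f.toLp n) := by
    funext n
    simp [conjNewton, NewtonSpace.coeff, NewtonSpace.toLp]
  rw [h1]
  exact h

/-- The value `∑ n, c n * N_n(z)` at `z` of the element of the Newton space with coefficients
`c n`. -/
def NewtonSpace.eval (f : NewtonSpace) (z : HalfPlane) : ℂ :=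
  ∑' n : ℕ, f.coeff n * newtonPoly n z

theorem eval_eq_inner (f : NewtonSpace) (z : HalfPlane) :
    f.eval z = inner ℂ (conjNewton z) f :=
  (hasSum_inner_conjNewton z f).tsum_eq

theorem newtonPoly_natCast_of_lt {n k : ℕ} (h : k < n) : newtonPoly n (k : ℂ) = 0 := by
  have : ∏ j ∈ Finset.range n, ((k : ℂ) - j) = 0 :=
    Finset.prod_eq_zero (Finset.mem_range.2 h) (sub_self _)
  simp [newtonPoly, this]

theorem newtonPoly_natCast_self_ne_zero (k : ℕ) : newtonPoly k (k : ℂ) ≠ 0 := by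
  have h : ∏ j ∈ Finset.range k, ((k : ℂ) - j) ≠ 0 := by
    refine Finset.prod_ne_zero_iff.2 fun j hj => sub_ne_zero.2 ?_
    exact_mod_cast (Finset.mem_range.1 hj).ne'
  have h1 : (k.factorial : ℂ) ≠ 0 := by exact_mod_cast k.factorial_ne_zero
  exact div_ne_zero (mul_ne_zero (pow_ne_zero _ (by norm_num)) h) h1

theorem coeff_eq_zero_of_eval_eq_zero (f : NewtonSpace) (hf : ∀ z, f.eval z = 0) (k : ℕ) :
    f.coeff k = 0 := by
  induction k using Nat.strong_induction_on with
  | _ k ih =>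
    have hk : -(1 / 2 : ℝ) < ((k : ℂ)).re := by
      have : (0 : ℝ) ≤ k := k.cast_nonneg
      simp only [Complex.natCast_re]
      linarith
    have h := hf ⟨k, hk⟩
    rw [NewtonSpace.eval, tsum_eq_single k] at h
    · exact (mul_eq_zero.1 h).resolve_right (newtonPoly_natCast_self_ne_zero k)
    · intro n hn
      rcases lt_or_gt_of_ne hn with h1 | h1
      · simp [ih n h1]
      · simp [newtonPoly_natCast_of_lt h1]

/-- The Newton space as a reproducing kernel Hilbert space of functions on the half-plane
`Re z > -1/2`. -/
instance : RKHS ℂ NewtonSpace HalfPlane ℂ where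
  coeCLM := ContinuousLinearMap.pi fun z => innerSL ℂ (conjNewton z)
  coeCLM_injective := by
    intro f g hfg
    have h0 : ∀ z, (f - g).eval z = 0 := by
      intro z
      rw [eval_eq_inner, inner_sub_right, sub_eq_zero]
      exact congrFun hfg z
    have h1 := coeff_eq_zero_of_eval_eq_zero (f - g) h0
    refine sub_eq_zero.1 ?_
    exact lp.ext (funext h1)

theorem NewtonSpace.apply_eq_eval (f : NewtonSpace) (z : HalfPlane) : f z = f.eval z :=
  (eval_eq_inner f z).symm

/-- The reproducing kernel function `K_w` of the Newton space: the element with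
`⟨f, K_w⟩ = f(w)` for all `f`. -/
def kernelFun (w : HalfPlane) : NewtonSpace := RKHS.kerFun NewtonSpace w 1

theorem inner_kernelFun (w : HalfPlane) (f : NewtonSpace) :
    inner ℂ (kernelFun w) f = f w := by
  simp [kernelFun]

/-- The normalized reproducing kernel function `k_w = K_w / ‖K_w‖`. -/
def normalizedKernel (w : HalfPlane) : NewtonSpace :=
  ((‖kernelFun w‖⁻¹ : ℝ) : ℂ) • kernelFun w

/-! ### Elements of the Newton space as elements of `L²(μ)` -/

/-- `f` has the non-tangential limit `l` at the point `z₀` of the line `Re z = -1/2`: `f(z)` tends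
to `l` as `z` tends to `z₀` inside each sector `|z - z₀| < C (Re z + 1/2)`. -/
def HasNontangentialLimit (f : HalfPlane → ℂ) (z₀ l : ℂ) : Prop :=
  ∀ C : ℝ, Tendsto f
    (comap (fun z : HalfPlane => (z : ℂ)) (𝓝 z₀) ⊓
      𝓟 {z : HalfPlane | ‖(z : ℂ) - z₀‖ < C * ((z : ℂ).re + 1 / 2)})
    (𝓝 l)

/-- The element `g` of `L²(μ)` is the element `f` of the Newton space, extended to the line
`Re z = -1/2` by its non-tangential boundary function. -/
def Represents (g : Lp ℂ 2 mu) (f : NewtonSpace) : Prop :=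
  ∀ᵐ z ∂mu, (∀ hz : -(1 / 2 : ℝ) < z.re, g z = f ⟨z, hz⟩) ∧
    (z.re = -(1 / 2 : ℝ) → HasNontangentialLimit f z (g z))

end Newton

end

/-!
For `0 < a, b ≤ 1`, Mellin inversion of `(1 + r) ^ (-(n + 1))`, whose Mellin transform on the line
`Re s = (n + 1) / 2` is `|Γ(s)|² / n!`, shows that the `n`-th line contributes
`(a b)ⁿ / (a + b)ⁿ⁺¹` to `⟨b^z, a^z⟩` in `L²(μ)`; hence `⟨b^z, a^z⟩ = 1 / (a + b - a b)`
(`inner_powH2`). By the binomial series `a^z = ∑ (1 - a)ⁿ N_n(z)`, so the functions `a^z` have the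
same Gram matrix in the Newton space.

The kernel `K_w(z) = ∑ conj (N_n(w)) N_n(z)` converges locally uniformly up to the line
`Re z = -1/2`, because `N_n(z) = O(n ^ (-Re z - 1))` and `Re w > -1/2`. Its boundary values are
therefore those of a continuous extension, and no general theory of boundary functions is needed.
To find `K_w` in `H²(μ)`, its coefficients are approximated by linear combinations of those of the
`a^z` in an `ℓ²` norm with weights `(n + 1) ^ δ`, `δ > 0` small. These combinations converge in
`H²(μ)`, by equality of the Gram matrices, and also pointwise on the closed half-plane, since the
weights make evaluation at boundary points continuous (`exists_kernel_mem_H2`).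

The operators act by `T_{s^z} a^z = (s a)^z`, which gives
`T_{c^z}^* a^z = (a + c - a c)⁻¹ (a / (a + c - a c))^z` and `T_{c^z}^* k_w = conj (c^w) k_w`.
On the functions `a^z` one checks the commutation relation
`T_{t^z}^* T_{s^z} = D⁻¹ T_{(s/D)^z} T_{(t/D)^z}^*` with `D = s + t - s t`
(`adjoint_toeplitz_comp_toeplitz`). Hence
`⟨T_{t^z}^* T_{s^z} k_w, k_w⟩ = D⁻¹ ⟨T_{(t/D)^z}^* k_w, T_{(s/D)^z}^* k_w⟩`, where both adjoints act
by scalars, and the formula follows.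
-/

namespace Newton

/-! ### Integrals of `|Γ|²` along vertical lines -/

theorem image_div_one_sub : (fun u : ℝ => u / (1 - u)) '' Ioo 0 1 = Ioi 0 := by
  ext r
  constructor
  · rintro ⟨u, hu, rfl⟩
    exact div_pos hu.1 (by linarith [hu.2])
  · intro hr
    have hr' : (0 : ℝ) < r := hr
    have h1 : (0 : ℝ) < 1 + r := by linarith
    refine ⟨r / (1 + r), ⟨by positivity, by rw [div_lt_one h1]; linarith⟩, ?_⟩
    simp only
    field_simp
    ring

theorem hasDerivAt_div_one_sub {u : ℝ} (hu : u ∈ Ioo (0 : ℝ) 1) :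
    HasDerivAt (fun u : ℝ => u / (1 - u)) (1 / (1 - u) ^ 2) u := by
  have h : 1 - u ≠ 0 := by linarith [hu.2]
  refine ((hasDerivAt_id' u).fun_div ((hasDerivAt_id' u).const_sub 1) h).congr_deriv ?_
  simp

theorem injOn_div_one_sub : InjOn (fun u : ℝ => u / (1 - u)) (Ioo 0 1) := by
  intro u hu v hv h
  have h1 : 1 - u ≠ 0 := by linarith [hu.2]
  have h2 : 1 - v ≠ 0 := by linarith [hv.2]
  simp only at h
  rw [div_eq_div_iff h1 h2] at h
  linarith

/-- The function `r ↦ (1 + r) ^ (-(n + 1))`, whose Mellin transform is `Γ(s) Γ(n + 1 - s) / n!`. -/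
noncomputable def invPow (n : ℕ) (r : ℝ) : ℂ := (((1 + r) ^ (n + 1))⁻¹ : ℝ)

/-- The substitution `r = u / (1 - u)` turns the Mellin integral of `invPow n` into a Beta
integral. -/
theorem invPow_substitution (n : ℕ) (s : ℂ) {u : ℝ} (hu : u ∈ Ioo (0 : ℝ) 1) :
    |1 / (1 - u) ^ 2| • (((u / (1 - u) : ℝ) : ℂ) ^ (s - 1) • invPow n (u / (1 - u))) =
      (u : ℂ) ^ (s - 1) * (1 - (u : ℂ)) ^ ((n + 1 - s : ℂ) - 1) := by
  have h1 : (0 : ℝ) < 1 - u := by linarith [hu.2]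
  have h1c : (1 - u : ℂ) ≠ 0 := by exact_mod_cast h1.ne'
  have h2 : invPow n (u / (1 - u)) = (1 - u : ℂ) ^ (n + 1) := by
    rw [invPow, show 1 + u / (1 - u) = (1 - u)⁻¹ by field_simp; ring]
    push_cast
    simp
  have h3 : ((u / (1 - u) : ℝ) : ℂ) ^ (s - 1) = (u : ℂ) ^ (s - 1) * (1 - u : ℂ) ^ (1 - s) := by
    rw [div_eq_mul_inv]
    push_cast
    have h4 := Complex.mul_cpow_ofReal_nonneg hu.1.le (inv_nonneg.2 h1.le) (s - 1)
    push_cast at h4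
    rw [h4, show (1 - s) = -(s - 1) by ring, Complex.cpow_neg, Complex.inv_cpow]
    have := Complex.arg_ofReal_of_nonneg h1.le
    push_cast at this
    rw [this]
    exact Real.pi_pos.ne
  rw [h2, h3, abs_of_pos (by positivity), Complex.real_smul, smul_eq_mul,
    show (n + 1 - s : ℂ) - 1 = (1 - s) + ((n + 1 : ℕ) : ℂ) - (2 : ℕ) by push_cast; ring,
    Complex.cpow_sub (1 - s + ((n + 1 : ℕ) : ℂ)) _ h1c,
    Complex.cpow_add (1 - s) _ h1c, Complex.cpow_natCast, Complex.cpow_natCast]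
  push_cast
  field_simp

theorem mellinConvergent_invPow (n : ℕ) {s : ℂ} (hs : 0 < s.re) (hs' : s.re < n + 1) :
    MellinConvergent (invPow n) s := by
  have h := Complex.betaIntegral_convergent (u := s) (v := n + 1 - s) hs (by simpa using hs')
  rw [intervalIntegrable_iff_integrableOn_Ioo_of_le zero_le_one] at h
  rw [MellinConvergent, ← image_div_one_sub,
    integrableOn_image_iff_integrableOn_abs_deriv_smul measurableSet_Ioo
      (fun u hu => (hasDerivAt_div_one_sub hu).hasDerivWithinAt) injOn_div_one_sub]
  exact h.congr_fun (fun u hu => (invPow_substitution n s hu).symm) measurableSet_Ioo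

theorem mellin_invPow (n : ℕ) {s : ℂ} (hs : 0 < s.re) (hs' : s.re < n + 1) :
    mellin (invPow n) s = Complex.Gamma s * Complex.Gamma (n + 1 - s) / n.factorial := by
  have h : mellin (invPow n) s = Complex.betaIntegral s (n + 1 - s) := by
    rw [mellin, ← image_div_one_sub,
      integral_image_eq_integral_abs_deriv_smul measurableSet_Ioo
        (fun u hu => (hasDerivAt_div_one_sub hu).hasDerivWithinAt) injOn_div_one_sub,
      Complex.betaIntegral, intervalIntegral.integral_of_le zero_le_one,
      integral_Ioc_eq_integral_Ioo]
    exact setIntegral_congr_fun measurableSet_Ioo fun u hu => invPow_substitution n s hu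
  have h0 : (n.factorial : ℂ) ≠ 0 := by exact_mod_cast n.factorial_ne_zero
  rw [h, eq_div_iff h0, Complex.Gamma_mul_Gamma_eq_betaIntegral hs (by simpa using hs'),
    add_sub_cancel, Complex.Gamma_nat_eq_factorial, mul_comm]

theorem linePoint_add_one (n : ℕ) (y : ℝ) :
    linePoint n y + 1 = (((n + 1) / 2 : ℝ) : ℂ) + y * Complex.I := by
  simp only [linePoint]
  push_cast
  ring

theorem linePoint_re (n : ℕ) (y : ℝ) : (linePoint n y).re = (n - 1) / 2 := by
  simp [linePoint]

theorem linePoint_add_one_re_pos (n : ℕ) (y : ℝ) : 0 < (linePoint n y + 1).re := by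
  have : (0 : ℝ) ≤ n := n.cast_nonneg
  simp only [Complex.add_re, linePoint_re, Complex.one_re]
  linarith

theorem conj_linePoint (n : ℕ) (y : ℝ) : conj (linePoint n y) = n - 1 - linePoint n y := by
  apply Complex.ext
  · simp [linePoint_re]
    ring
  · simp [linePoint, map_ofNat]

/-- On the line `Re s = (n + 1) / 2` one has `n + 1 - s = conj s`, so that the Mellin transform of
`invPow n` is `|Γ|² / n!` there. -/
theorem mellin_invPow_line (n : ℕ) (y : ℝ) :
    mellin (invPow n) (linePoint n y + 1) = ((2 * Real.pi * lineDensity n y : ℝ) : ℂ) := by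
  have h2 := linePoint_re n y
  have hn : (0 : ℝ) ≤ n := n.cast_nonneg
  rw [mellin_invPow n (linePoint_add_one_re_pos n y) (by simp [h2]; linarith)]
  have h3 : (n + 1 - (linePoint n y + 1) : ℂ) = conj (linePoint n y + 1) := by
    rw [map_add, conj_linePoint, map_one]; ring
  rw [h3, Complex.Gamma_conj, Complex.mul_conj, Complex.normSq_eq_norm_sq, lineDensity]
  push_cast
  have : (Real.pi : ℂ) ≠ 0 := by exact_mod_cast Real.pi_ne_zero
  field_simp

theorem norm_Gamma_le_Gamma_re {s : ℂ} (hs : 0 < s.re) : ‖Complex.Gamma s‖ ≤ Real.Gamma s.re := by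
  rw [Complex.Gamma_eq_integral hs, Complex.GammaIntegral, Real.Gamma_eq_integral hs]
  refine (norm_integral_le_integral_norm _).trans (le_of_eq ?_)
  refine setIntegral_congr_fun measurableSet_Ioi fun x hx => ?_
  simp [Complex.norm_cpow_eq_rpow_re_of_pos hx, Complex.norm_exp]

theorem continuous_lineDensity (n : ℕ) : Continuous (lineDensity n) := by
  unfold lineDensity
  refine Continuous.div_const (Continuous.pow (Continuous.norm ?_) 2) _
  rw [continuous_iff_continuousAt]
  intro y
  have h1 := linePoint_add_one_re_pos n y
  have h : ContinuousAt Complex.Gamma (linePoint n y + 1) := by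
    refine (Complex.differentiableAt_Gamma _ fun m hm => ?_).continuousAt
    rw [hm] at h1
    have : (0 : ℝ) ≤ m := m.cast_nonneg
    simp at h1
    linarith
  exact ContinuousAt.comp (f := fun y => linePoint n y + 1) h
    ((continuous_linePoint n).add continuous_const).continuousAt

theorem lineDensity_nonneg (n : ℕ) (y : ℝ) : 0 ≤ lineDensity n y := by
  unfold lineDensity
  positivity

theorem integrable_lineDensity (n : ℕ) : Integrable (lineDensity n) := by
  set σ : ℝ := (n + 1) / 2 with hσ
  have hσ0 : 1 / 2 ≤ σ := by
    have : (0 : ℝ) ≤ n := n.cast_nonneg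
    rw [hσ]; linarith
  -- `Γ(s) = Γ(s + 1) / s` gives quadratic decay
  refine Integrable.mono' ((integrable_inv_one_add_sq.const_mul
    (4 * Real.Gamma (σ + 1) ^ 2)).div_const (2 * Real.pi * n.factorial))
    (continuous_lineDensity n).aestronglyMeasurable (Eventually.of_forall fun y => ?_)
  rw [Real.norm_of_nonneg (lineDensity_nonneg n y), lineDensity]
  gcongr
  have hre := linePoint_add_one_re_pos n y
  have hs : linePoint n y + 1 = (σ : ℂ) + y * Complex.I := linePoint_add_one n y
  have h0 : linePoint n y + 1 ≠ 0 := fun h => by rw [h] at hre; simp at hre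
  have h1 := Complex.Gamma_add_one _ h0
  rw [hs] at h0 h1 ⊢
  have h2 : ‖Complex.Gamma (σ + y * Complex.I + 1)‖ ≤ Real.Gamma (σ + 1) := by
    refine (norm_Gamma_le_Gamma_re ?_).trans_eq ?_ <;> simp
    linarith
  rw [h1, norm_mul] at h2
  have h3 : ‖(σ + y * Complex.I : ℂ)‖ ^ 2 = σ ^ 2 + y ^ 2 := by
    rw [← Complex.normSq_eq_norm_sq, Complex.normSq_apply]; simp; ring
  have h4 : (σ ^ 2 + y ^ 2) * ‖Complex.Gamma (σ + y * Complex.I)‖ ^ 2 ≤ Real.Gamma (σ + 1) ^ 2 := by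
    rw [← h3, ← mul_pow]
    gcongr
  have h5 : (1 + y ^ 2) / 4 ≤ σ ^ 2 + y ^ 2 := by nlinarith [sq_nonneg y]
  rw [← div_eq_mul_inv, le_div_iff₀ (by positivity)]
  nlinarith [sq_nonneg ‖Complex.Gamma (σ + y * Complex.I)‖]

/-- Mellin inversion on the line carrying the density. -/
theorem integral_cpow_mul_lineDensity (n : ℕ) {c : ℝ} (hc : 0 < c) :
    ∫ y : ℝ, (c : ℂ) ^ (-(linePoint n y + 1)) * (lineDensity n y : ℂ) =
      (((1 + c) ^ (n + 1))⁻¹ : ℝ) := by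
  have hn : (0 : ℝ) ≤ n := n.cast_nonneg
  have h := mellinInv_mellin_eq ((n + 1) / 2 : ℝ) (invPow n) hc
    (mellinConvergent_invPow n (by simp; norm_cast; linarith) (by simp; norm_cast; linarith)) ?_ ?_
  · rw [invPow, mellinInv] at h
    rw [← h, ← integral_smul]
    congr 1
    funext y
    rw [← linePoint_add_one, mellin_invPow_line, smul_eq_mul, Complex.real_smul]
    push_cast
    have : (Real.pi : ℂ) ≠ 0 := by exact_mod_cast Real.pi_ne_zero
    field_simp
  · unfold Complex.VerticalIntegrable
    simp_rw [← linePoint_add_one, mellin_invPow_line]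
    exact ((integrable_lineDensity n).const_mul _).ofReal
  · refine Complex.continuous_ofReal.continuousAt.comp (ContinuousAt.inv₀ (by fun_prop) ?_)
    positivity

/-! ### The functions `z ↦ a ^ z` in `L²(μ)` -/

/-- The part of `μ` carried by the line `Re z = (n - 1) / 2`. -/
noncomputable def lineMeasure (n : ℕ) : Measure ℂ :=
  ((volume : Measure ℝ).withDensity fun y => ENNReal.ofReal (lineDensity n y)).map (linePoint n)

theorem mu_eq_sum : mu = Measure.sum lineMeasure := rfl

theorem measurable_ofReal_lineDensity (n : ℕ) :
    Measurable fun y => ENNReal.ofReal (lineDensity n y) :=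
  (continuous_lineDensity n).measurable.ennreal_ofReal

theorem integrable_lineMeasure_iff (n : ℕ) {F : ℂ → ℂ} (hF : Continuous F) :
    Integrable F (lineMeasure n) ↔
      Integrable fun y => (lineDensity n y : ℂ) * F (linePoint n y) := by
  rw [lineMeasure, integrable_map_measure hF.aestronglyMeasurable
    (continuous_linePoint n).measurable.aemeasurable,
    integrable_withDensity_iff_integrable_smul' (measurable_ofReal_lineDensity n)
      (Eventually.of_forall fun y => ENNReal.ofReal_lt_top)]
  simp [ENNReal.toReal_ofReal (lineDensity_nonneg n _)]

theorem integral_lineMeasure {E : Type*} [NormedAddCommGroup E] [NormedSpace ℝ E]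
    (n : ℕ) {F : ℂ → E} (hF : Continuous F) :
    ∫ z, F z ∂(lineMeasure n) = ∫ y, lineDensity n y • F (linePoint n y) := by
  rw [lineMeasure, integral_map (continuous_linePoint n).measurable.aemeasurable
    hF.aestronglyMeasurable, integral_withDensity_eq_integral_toReal_smul
      (measurable_ofReal_lineDensity n) (Eventually.of_forall fun y => ENNReal.ofReal_lt_top)]
  simp [ENNReal.toReal_ofReal (lineDensity_nonneg n _)]

theorem integral_lineDensity (n : ℕ) : ∫ y, lineDensity n y = ((2 : ℝ) ^ (n + 1))⁻¹ := by
  have h := integral_cpow_mul_lineDensity n one_pos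
  simp only [Complex.ofReal_one, Complex.one_cpow, one_mul, integral_complex_ofReal] at h
  rw [Complex.ofReal_inj.1 h]
  norm_num

theorem continuous_ofReal_cpow {a : ℝ} (ha : 0 < a) : Continuous fun z : ℂ => (a : ℂ) ^ z :=
  continuous_id.const_cpow (Or.inl (by exact_mod_cast ha.ne'))

theorem continuous_conj_cpow_mul_cpow {a b : ℝ} (ha : 0 < a) (hb : 0 < b) :
    Continuous fun z : ℂ => conj ((a : ℂ) ^ z) * (b : ℂ) ^ z :=
  (Complex.continuous_conj.comp (continuous_ofReal_cpow ha)).mul (continuous_ofReal_cpow hb)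

theorem conj_ofReal_cpow {a : ℝ} (ha : 0 < a) (z : ℂ) :
    conj ((a : ℂ) ^ z) = (a : ℂ) ^ (conj z) := by
  have := Complex.cpow_conj (a : ℂ) z (by
    rw [Complex.arg_ofReal_of_nonneg ha.le]; exact Real.pi_pos.ne)
  rw [this, Complex.conj_ofReal]

theorem conj_cpow_mul_cpow_linePoint {a b : ℝ} (ha : 0 < a) (hb : 0 < b) (n : ℕ) (y : ℝ) :
    conj ((a : ℂ) ^ linePoint n y) * (b : ℂ) ^ linePoint n y =
      (a : ℂ) ^ n / b * ((a / b : ℝ) : ℂ) ^ (-(linePoint n y + 1)) := by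
  have ha0 : (a : ℂ) ≠ 0 := by exact_mod_cast ha.ne'
  have hb0 : (b : ℂ) ≠ 0 := by exact_mod_cast hb.ne'
  rw [conj_ofReal_cpow ha, conj_linePoint]
  set z := linePoint n y
  have h1 : ((a / b : ℝ) : ℂ) ^ (-(z + 1)) = (a : ℂ) ^ (-(z + 1)) * (b : ℂ) ^ (z + 1) := by
    have h := Complex.mul_cpow_ofReal_nonneg ha.le (inv_nonneg.2 hb.le) (-(z + 1))
    rw [div_eq_mul_inv, Complex.ofReal_mul, h, Complex.ofReal_inv,
      Complex.inv_cpow _ _ (by rw [Complex.arg_ofReal_of_nonneg hb.le]; exact Real.pi_pos.ne),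
      ← Complex.cpow_neg, neg_neg]
  rw [h1, show (n - 1 - z : ℂ) = (n : ℕ) + (-(z + 1)) by ring, Complex.cpow_add _ _ ha0,
    Complex.cpow_natCast, Complex.cpow_add _ _ hb0, Complex.cpow_one]
  field_simp

theorem norm_conj_cpow_mul_cpow {a b : ℝ} (ha : 0 < a) (hb : 0 < b) (z : ℂ) :
    ‖conj ((a : ℂ) ^ z) * (b : ℂ) ^ z‖ = (a * b) ^ z.re := by
  rw [norm_mul, RCLike.norm_conj, Complex.norm_cpow_eq_rpow_re_of_pos ha,
    Complex.norm_cpow_eq_rpow_re_of_pos hb, Real.mul_rpow ha.le hb.le]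

theorem integrable_conj_cpow_mul_cpow {a b : ℝ} (ha : a ∈ Ioc (0 : ℝ) 1) (hb : b ∈ Ioc (0 : ℝ) 1) :
    Integrable (fun z : ℂ => conj ((a : ℂ) ^ z) * (b : ℂ) ^ z) mu := by
  have hcont := continuous_conj_cpow_mul_cpow ha.1 hb.1
  have hab : 0 < a * b := mul_pos ha.1 hb.1
  have hab1 : a * b ≤ 1 := mul_le_one₀ ha.2 hb.1.le hb.2
  rw [mu_eq_sum]
  refine integrable_sum_measure (fun n => ?_) ?_
  · rw [integrable_lineMeasure_iff n hcont]
    refine (integrable_lineDensity n).ofReal.mul_bdd (c := (a * b) ^ (((n : ℝ) - 1) / 2)) ?_ ?_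
    · exact (hcont.comp (continuous_linePoint n)).aestronglyMeasurable
    · refine Eventually.of_forall fun y => ?_
      rw [norm_conj_cpow_mul_cpow ha.1 hb.1, linePoint_re]
  · have h : ∀ n : ℕ, ∫ z, ‖conj ((a : ℂ) ^ z) * (b : ℂ) ^ z‖ ∂lineMeasure n =
        ((2 : ℝ) ^ (n + 1))⁻¹ * (a * b) ^ (((n : ℝ) - 1) / 2) := by
      intro n
      rw [integral_lineMeasure n hcont.norm]
      simp_rw [norm_conj_cpow_mul_cpow ha.1 hb.1, linePoint_re, smul_eq_mul]
      rw [integral_mul_const, integral_lineDensity]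
    simp_rw [h]
    refine Summable.of_nonneg_of_le (fun n => by positivity) (fun n => ?_)
      (summable_geometric_two.mul_right ((a * b) ^ (-(1 / 2) : ℝ)))
    have h1 : (a * b) ^ (((n : ℝ) - 1) / 2) ≤ (a * b) ^ (-(1 / 2) : ℝ) := by
      refine Real.rpow_le_rpow_of_exponent_ge hab hab1 ?_
      have : (0 : ℝ) ≤ n := n.cast_nonneg
      linarith
    have h2 : ((2 : ℝ) ^ (n + 1))⁻¹ ≤ (1 / 2) ^ n := by
      rw [one_div, inv_pow]
      refine inv_anti₀ (by positivity) (pow_le_pow_right₀ (by norm_num) (by omega))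
    exact mul_le_mul h2 h1 (by positivity) (by positivity)

/-- Summing `(a b)ⁿ / (a + b)ⁿ⁺¹`, the contribution of the `n`-th line, over `n`. -/
theorem integral_conj_cpow_mul_cpow {a b : ℝ} (ha : a ∈ Ioc (0 : ℝ) 1) (hb : b ∈ Ioc (0 : ℝ) 1) :
    ∫ z, conj ((a : ℂ) ^ z) * (b : ℂ) ^ z ∂mu = ((a + b - a * b)⁻¹ : ℝ) := by
  have hcont := continuous_conj_cpow_mul_cpow ha.1 hb.1
  have hint := integrable_conj_cpow_mul_cpow ha hb
  have ha0 := ha.1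
  have hb0 := hb.1
  rw [mu_eq_sum] at hint ⊢
  have hn : ∀ n : ℕ, ∫ z, conj ((a : ℂ) ^ z) * (b : ℂ) ^ z ∂lineMeasure n =
      ((a + b)⁻¹ * (a * b / (a + b)) ^ n : ℝ) := by
    intro n
    have h := integral_cpow_mul_lineDensity n (div_pos ha0 hb0)
    rw [integral_lineMeasure n hcont]
    simp_rw [conj_cpow_mul_cpow_linePoint ha0 hb0]
    have h1 : ∀ y, lineDensity n y •
        ((a : ℂ) ^ n / b * ((a / b : ℝ) : ℂ) ^ (-(linePoint n y + 1))) =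
        (a : ℂ) ^ n / b * (((a / b : ℝ) : ℂ) ^ (-(linePoint n y + 1)) * (lineDensity n y : ℂ)) := by
      intro y
      rw [Complex.real_smul]; ring
    simp_rw [h1]
    rw [integral_const_mul, h]
    norm_cast
    have : 1 + a / b = (a + b) / b := by field_simp; ring
    rw [this, div_pow, div_pow, mul_pow]
    field_simp
    ring
  have hs := hasSum_integral_measure hint
  simp_rw [hn] at hs
  refine hs.unique (Complex.hasSum_ofReal.2 ?_)
  have hab : a * b / (a + b) < 1 := by
    rw [div_lt_one (by positivity)]
    nlinarith [ha.2]
  have hd : a + b - a * b ≠ 0 := by nlinarith [ha.2]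
  have hr : (a + b - a * b)⁻¹ = (a + b)⁻¹ * (1 - a * b / (a + b))⁻¹ := by
    rw [← mul_inv]
    congr 1
    field_simp
  rw [hr]
  exact (hasSum_geometric_of_lt_one (by positivity) hab).mul_left (a + b)⁻¹

theorem memLp_two_cpow {a : ℝ} (ha : a ∈ Ioc (0 : ℝ) 1) :
    MemLp (fun z : ℂ => (a : ℂ) ^ z) 2 mu := by
  rw [memLp_two_iff_integrable_sq_norm (continuous_ofReal_cpow ha.1).aestronglyMeasurable]
  refine (integrable_conj_cpow_mul_cpow ha ha).norm.congr (Eventually.of_forall fun z => ?_)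
  simp [pow_two]

theorem cpow_mem_H2 {a : ℝ} (ha : a ∈ Ioc (0 : ℝ) 1) : (memLp_two_cpow ha).toLp _ ∈ H2 :=
  Submodule.le_topologicalClosure _
    (Submodule.subset_span ⟨a, ha.1, ha.2, MemLp.coeFn_toLp _⟩)

/-- The function `z ↦ a ^ z`, `0 < a ≤ 1`, as an element of `H²(μ)`. -/
noncomputable def powH2 (a : Ioc (0 : ℝ) 1) : H2 := ⟨(memLp_two_cpow a.2).toLp _, cpow_mem_H2 a.2⟩

theorem coeFn_powH2 (a : Ioc (0 : ℝ) 1) :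
    (powH2 a : Lp ℂ 2 mu) =ᵐ[mu] fun z : ℂ => ((a : ℝ) : ℂ) ^ z :=
  (memLp_two_cpow a.2).coeFn_toLp

theorem inner_powH2 (a b : Ioc (0 : ℝ) 1) :
    inner ℂ (powH2 a) (powH2 b) = (((a + b - a * b : ℝ)⁻¹ : ℝ) : ℂ) := by
  rw [← integral_conj_cpow_mul_cpow a.2 b.2, Submodule.coe_inner, L2.inner_def]
  refine integral_congr_ae ?_
  filter_upwards [coeFn_powH2 a, coeFn_powH2 b] with z h1 h2
  rw [h1, h2, RCLike.inner_apply, mul_comm]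

/-- The functions `z ↦ a ^ z` span a dense subspace of `H²(μ)`, so that they separate vectors. -/
theorem ext_inner_powH2 {x y : H2} (h : ∀ a, inner ℂ (powH2 a) x = inner ℂ (powH2 a) y) :
    x = y := by
  rw [← sub_eq_zero]
  have h0 : ∀ v : Lp ℂ 2 mu, v ∈ H2 → inner ℂ v ((x - y : H2) : Lp ℂ 2 mu) = 0 := by
    intro v hv
    have h1 : H2 ≤ (ℂ ∙ ((x - y : H2) : Lp ℂ 2 mu))ᗮ := by
      refine Submodule.topologicalClosure_minimal _ (Submodule.span_le.2 ?_)
        (Submodule.isClosed_orthogonal _)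
      rintro f ⟨a, ha, ha1, hf⟩
      have h2 : f = (powH2 ⟨a, ha, ha1⟩ : Lp ℂ 2 mu) := by
        refine Lp.ext (hf.trans ?_)
        exact (coeFn_powH2 ⟨a, ha, ha1⟩).symm
      rw [SetLike.mem_coe, Submodule.mem_orthogonal_singleton_iff_inner_left, h2]
      rw [← Submodule.coe_inner, inner_sub_right, h, sub_self]
    exact Submodule.mem_orthogonal_singleton_iff_inner_left.1 (h1 hv)
  have h3 := h0 _ (x - y).2
  rw [← Submodule.coe_inner, inner_self_eq_zero] at h3
  exact h3

/-! ### Newton polynomials -/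

theorem descPochhammer_smeval_eq_prod (n : ℕ) (z : ℂ) :
    (descPochhammer ℤ n).smeval z = ∏ j ∈ Finset.range n, (z - j) := by
  induction n with
  | zero => simp
  | succ n ih =>
    rw [descPochhammer_succ_right, Polynomial.smeval_mul, ih, Finset.prod_range_succ,
      Polynomial.smeval_sub, Polynomial.smeval_X, Polynomial.smeval_natCast]
    simp

theorem newtonPoly_eq_choose (n : ℕ) (z : ℂ) : newtonPoly n z = (-1) ^ n * Ring.choose z n := by
  have h1 : (n.factorial : ℂ) ≠ 0 := by exact_mod_cast n.factorial_ne_zero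
  rw [newtonPoly, ← descPochhammer_smeval_eq_prod, Ring.descPochhammer_eq_factorial_smul_choose,
    nsmul_eq_mul]
  field_simp

/-- The binomial series of `(1 - (1 - a)) ^ z`. -/
theorem hasSum_pow_mul_newtonPoly {a : ℝ} (ha : a ∈ Ioc (0 : ℝ) 1) (z : ℂ) :
    HasSum (fun n : ℕ => (((1 - a) ^ n : ℝ) : ℂ) * newtonPoly n z) ((a : ℂ) ^ z) := by
  have hmem : ((a : ℂ) - 1) ∈ Metric.eball (0 : ℂ) 1 := by
    have : ‖((a : ℂ) - 1)‖ < 1 := by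
      rw [← Complex.ofReal_one, ← Complex.ofReal_sub, Complex.norm_real, Real.norm_eq_abs, abs_lt]
      constructor <;> linarith [ha.1, ha.2]
    rw [Metric.mem_eball, edist_zero_right, ← ofReal_norm]
    exact_mod_cast ENNReal.ofReal_lt_one.2 this
  have h := (Complex.one_add_cpow_hasFPowerSeriesOnBall_zero (a := z)).hasSum hmem
  simp only [zero_add, add_sub_cancel, binomialSeries_apply] at h
  have hterm : ∀ n : ℕ, (((1 - a) ^ n : ℝ) : ℂ) * newtonPoly n z =
      Ring.choose z n • (List.ofFn fun _ : Fin n => (a : ℂ) - 1).prod := by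
    intro n
    rw [newtonPoly_eq_choose]
    simp only [List.ofFn_const, List.prod_replicate, smul_eq_mul]
    push_cast
    rw [show (a : ℂ) - 1 = -1 * (1 - a) by ring, mul_pow]
    ring
  rw [funext hterm]
  exact h

/-- The factor `|n - z| / (n + 1) = |1 - (z + 1) / (n + 1)|` is bounded by an exponential, using
`1 + x ≤ exp x` for its square. -/
theorem norm_newtonPoly_succ_le (n : ℕ) (z : ℂ) :
    ‖newtonPoly (n + 1) z‖ ≤ ‖newtonPoly n z‖ *
      Real.exp (‖z + 1‖ ^ 2 / 2 * ((n + 1 : ℝ) ^ 2)⁻¹ - (z.re + 1) * (n + 1 : ℝ)⁻¹) := by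
  rw [newtonPoly_succ, norm_mul]
  refine mul_le_mul_of_nonneg_left ?_ (norm_nonneg _)
  refine le_of_sq_le_sq ?_ (Real.exp_pos _).le
  have hp : (0 : ℝ) < n + 1 := by positivity
  have h1 : ‖((n : ℂ) - z) / (n + 1)‖ ^ 2 =
      2 * (‖z + 1‖ ^ 2 / 2 * ((n + 1 : ℝ) ^ 2)⁻¹ - (z.re + 1) * (n + 1 : ℝ)⁻¹) + 1 := by
    have h2 : ‖((n : ℂ) + 1)‖ = n + 1 := by
      have := Complex.norm_natCast (n + 1)
      push_cast at this
      exact this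
    rw [norm_div, h2, div_pow, ← Complex.normSq_eq_norm_sq, ← Complex.normSq_eq_norm_sq,
      Complex.normSq_apply, Complex.normSq_apply]
    simp
    field_simp
    ring
  rw [h1, ← Real.exp_nat_mul]
  exact_mod_cast Real.add_one_le_exp _

theorem norm_newtonPoly_le_exp (n : ℕ) (z : ℂ) :
    ‖newtonPoly n z‖ ≤ Real.exp (‖z + 1‖ ^ 2 / 2 * (∑ k ∈ Finset.range n, ((k + 1 : ℝ) ^ 2)⁻¹) -
      (z.re + 1) * ∑ k ∈ Finset.range n, (k + 1 : ℝ)⁻¹) := by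
  induction n with
  | zero => simp [newtonPoly]
  | succ n ih =>
    refine (norm_newtonPoly_succ_le n z).trans ?_
    refine (mul_le_mul_of_nonneg_right ih (Real.exp_pos _).le).trans_eq ?_
    rw [← Real.exp_add, Finset.sum_range_succ, Finset.sum_range_succ]
    ring_nf

/-- The decay of the Newton polynomials, locally uniform on the closed half-plane. -/
theorem exists_norm_newtonPoly_le (R : ℝ) : ∃ C : ℝ, 0 ≤ C ∧ ∀ z : ℂ, -(1 / 2 : ℝ) ≤ z.re →
    ‖z‖ ≤ R → ∀ n : ℕ, ‖newtonPoly n z‖ ≤ C * (n + 1 : ℝ) ^ (-(z.re + 1)) := by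
  have hS : Summable fun k : ℕ => ((k + 1 : ℝ) ^ 2)⁻¹ := by
    have := (summable_nat_add_iff 1).2 (Real.summable_nat_pow_inv (p := 2).2 (by norm_num))
    exact_mod_cast this
  refine ⟨Real.exp ((R + 1) ^ 2 / 2 * ∑' k : ℕ, ((k + 1 : ℝ) ^ 2)⁻¹), (Real.exp_pos _).le,
    fun z hz hR n => ?_⟩
  have hp : (0 : ℝ) < n + 1 := by positivity
  refine (norm_newtonPoly_le_exp n z).trans ?_
  rw [Real.rpow_def_of_pos hp, ← Real.exp_add, Real.exp_le_exp]
  have h1 : ∑ k ∈ Finset.range n, ((k + 1 : ℝ) ^ 2)⁻¹ ≤ ∑' k : ℕ, ((k + 1 : ℝ) ^ 2)⁻¹ :=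
    hS.sum_le_tsum _ fun k _ => by positivity
  have h2 : Real.log (n + 1) ≤ ∑ k ∈ Finset.range n, (k + 1 : ℝ)⁻¹ := by
    have := log_add_one_le_harmonic n
    rw [harmonic] at this
    push_cast at this
    exact this
  have h3 : ‖z + 1‖ ^ 2 ≤ (R + 1) ^ 2 := by
    have : ‖z + 1‖ ≤ R + 1 := (norm_add_le _ _).trans (by simpa using hR)
    gcongr
  have h4 : ‖z + 1‖ ^ 2 / 2 * ∑ k ∈ Finset.range n, ((k + 1 : ℝ) ^ 2)⁻¹ ≤
      (R + 1) ^ 2 / 2 * ∑' k : ℕ, ((k + 1 : ℝ) ^ 2)⁻¹ := by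
    refine mul_le_mul (by linarith) h1 (Finset.sum_nonneg fun k _ => by positivity) (by positivity)
  nlinarith

theorem summable_add_one_rpow {p : ℝ} (hp : p < -1) : Summable fun n : ℕ => (n + 1 : ℝ) ^ p := by
  have := (summable_nat_add_iff 1).2 (Real.summable_nat_rpow.2 hp)
  exact_mod_cast this

theorem continuous_newtonPoly (n : ℕ) : Continuous (newtonPoly n) := by
  unfold newtonPoly
  fun_prop

/-- The reproducing kernel `K_w(z)`, for `z` in the closed half-plane. -/
noncomputable def kernelSeries (w z : ℂ) : ℂ := ∑' n : ℕ, conj (newtonPoly n w) * newtonPoly n z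

/-- For `Re w > -1/2` the kernel series converges locally uniformly up to the boundary of the
half-plane. -/
theorem continuousOn_kernelSeries {w : ℂ} (hw : -(1 / 2 : ℝ) < w.re) :
    ContinuousOn (kernelSeries w) {z : ℂ | -(1 / 2 : ℝ) ≤ z.re} := by
  intro z₀ hz₀
  obtain ⟨C, hC, hCb⟩ := exists_norm_newtonPoly_le ‖w‖
  obtain ⟨D, hD, hDb⟩ := exists_norm_newtonPoly_le (‖z₀‖ + 1)
  have hcont : ContinuousOn (kernelSeries w)
      ({z : ℂ | -(1 / 2 : ℝ) ≤ z.re} ∩ Metric.ball z₀ 1) := by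
    refine continuousOn_tsum (u := fun n : ℕ => C * D * (n + 1 : ℝ) ^ (-(w.re + 1) + (-(1 / 2))))
      (fun n => ((continuous_newtonPoly n).const_mul _).continuousOn)
      ((summable_add_one_rpow (by linarith)).mul_left _) ?_
    rintro n z ⟨hz, hzb⟩
    have hzR : ‖z‖ ≤ ‖z₀‖ + 1 := by
      have h1 := norm_sub_norm_le z z₀
      rw [Metric.mem_ball, dist_eq_norm] at hzb
      linarith
    have hp : (1 : ℝ) ≤ n + 1 := by simp
    have h1 := hCb w hw.le le_rfl n
    have h2 : ‖newtonPoly n z‖ ≤ D * (n + 1 : ℝ) ^ (-(1 / 2) : ℝ) := by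
      refine (hDb z hz hzR n).trans (mul_le_mul_of_nonneg_left ?_ hD)
      refine Real.rpow_le_rpow_of_exponent_le hp ?_
      have : -(1 / 2 : ℝ) ≤ z.re := hz
      linarith
    rw [norm_mul, RCLike.norm_conj, Real.rpow_add (by positivity)]
    refine (mul_le_mul h1 h2 (norm_nonneg _) (by positivity)).trans_eq (by ring)
  exact (hcont z₀ ⟨hz₀, Metric.mem_ball_self one_pos⟩).mono_of_mem_nhdsWithin
    (inter_mem_nhdsWithin _ (Metric.ball_mem_nhds _ one_pos))

/-! ### Weighted geometric sequences in `ℓ²` -/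

theorem memlp_two_of_summable {f : ℕ → ℂ} (h : Summable fun n => ‖f n‖ ^ 2) : Memℓp f 2 :=
  memℓp_gen (by simpa using h)

theorem memlp_rpow_mul_pow {δ : ℝ} (hδ : δ ≤ 1 / 2) (a : Ioc (0 : ℝ) 1) :
    Memℓp (fun n : ℕ => (((n + 1 : ℝ) ^ δ * (1 - a) ^ n : ℝ) : ℂ)) 2 := by
  have h0 : (0 : ℝ) ≤ 1 - a := by linarith [a.2.2]
  have h1 : (1 - a : ℝ) < 1 := by linarith [a.2.1]
  have h2 : (1 - a : ℝ) ^ 2 < 1 := by nlinarith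
  have h3 : ‖(1 - a : ℝ) ^ 2‖ < 1 := by rwa [Real.norm_of_nonneg (by positivity)]
  refine memlp_two_of_summable (Summable.of_nonneg_of_le (fun n => by positivity) (fun n => ?_)
    ((summable_pow_mul_geometric_of_norm_lt_one 1 h3).add
      (summable_pow_mul_geometric_of_norm_lt_one 0 h3)))
  have hp : (1 : ℝ) ≤ n + 1 := by simp
  -- since `2 δ ≤ 1`, the squares are at most `(n + 1) ((1 - a) ^ 2) ^ n`
  rw [Complex.norm_real, Real.norm_of_nonneg (by positivity), mul_pow, ← Real.rpow_mul_natCast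
    (by positivity), ← pow_mul, mul_comm n 2, pow_mul, ← add_mul, pow_one, pow_zero]
  refine mul_le_mul_of_nonneg_right ?_ (by positivity)
  calc (n + 1 : ℝ) ^ (δ * (2 : ℕ)) ≤ (n + 1 : ℝ) ^ (1 : ℝ) :=
        Real.rpow_le_rpow_of_exponent_le hp (by push_cast; linarith)
    _ = n + 1 := Real.rpow_one _

/-- The sequence `(n + 1) ^ δ * (1 - a) ^ n` in `ℓ²`. For `δ = 0` these are the Newton coefficients
of `z ↦ a ^ z`. -/
noncomputable def geomSeq {δ : ℝ} (hδ : δ ≤ 1 / 2) (a : Ioc (0 : ℝ) 1) : lp (fun _ : ℕ => ℂ) 2 :=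
  ⟨_, memlp_rpow_mul_pow hδ a⟩

theorem geomSeq_apply {δ : ℝ} (hδ : δ ≤ 1 / 2) (a : Ioc (0 : ℝ) 1) (n : ℕ) :
    geomSeq hδ a n = (((n + 1 : ℝ) ^ δ * (1 - a) ^ n : ℝ) : ℂ) := rfl

theorem inner_geomSeq {δ ε : ℝ} (hδ : δ ≤ 1 / 2) (hε : ε ≤ 1 / 2) (h0 : δ + ε = 0)
    (a b : Ioc (0 : ℝ) 1) :
    inner ℂ (geomSeq hδ a) (geomSeq hε b) = (((a + b - a * b : ℝ)⁻¹ : ℝ) : ℂ) := by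
  refine (lp.hasSum_inner _ _).unique ?_
  have h : ∀ n : ℕ, inner ℂ (geomSeq hδ a n) (geomSeq hε b n) =
      ((((1 - a) * (1 - b) : ℝ) ^ n : ℝ) : ℂ) := by
    intro n
    have h1 : (n + 1 : ℝ) ^ ε * (n + 1 : ℝ) ^ δ = 1 := by
      rw [← Real.rpow_add (by positivity), add_comm ε, h0, Real.rpow_zero]
    rw [geomSeq_apply, geomSeq_apply, RCLike.inner_apply, Complex.conj_ofReal, ← Complex.ofReal_mul,
      mul_mul_mul_comm, h1, one_mul, ← mul_pow, mul_comm (1 - (b : ℝ))]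
  simp_rw [h]
  refine Complex.hasSum_ofReal.2 ?_
  have ha := a.2
  have hb := b.2
  have h1 : (0 : ℝ) ≤ (1 - a) * (1 - b) := mul_nonneg (by linarith [ha.2]) (by linarith [hb.2])
  have h2 : (1 - a) * (1 - b) < (1 : ℝ) := by nlinarith [ha.1, ha.2, hb.1, hb.2]
  convert hasSum_geometric_of_lt_one h1 h2 using 2
  ring

/-- The weighted geometric sequences span a dense subspace: a sequence orthogonal to all of them is
the coefficient sequence, up to the weight, of a power series that vanishes on `(0, 1)`. -/
theorem span_geomSeq_dense {δ : ℝ} (hδ : δ ≤ 1 / 2) :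
    (Submodule.span ℂ (range (geomSeq hδ))).topologicalClosure = ⊤ := by
  rw [Submodule.topologicalClosure_eq_top_iff, Submodule.eq_bot_iff]
  intro v hv
  have h0 : ∀ a : Ioc (0 : ℝ) 1,
      HasSum (fun n : ℕ => (((n + 1 : ℝ) ^ δ : ℝ) * v n) * ((1 - a : ℝ) : ℂ) ^ n) 0 := by
    intro a
    have h1 := lp.hasSum_inner (𝕜 := ℂ) (geomSeq hδ a) v
    rw [(Submodule.mem_orthogonal _ _).1 hv _ (Submodule.subset_span (mem_range_self a))] at h1
    have h2 : ∀ n : ℕ, (((n + 1 : ℝ) ^ δ : ℝ) * v n) * ((1 - a : ℝ) : ℂ) ^ n =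
        inner ℂ (geomSeq hδ a n) (v n) := by
      intro n
      rw [geomSeq_apply, RCLike.inner_apply, Complex.conj_ofReal]
      push_cast
      ring
    rw [funext h2]
    exact h1
  set u : ℕ → ℂ := fun n => ((n + 1 : ℝ) ^ δ : ℝ) * v n with hu
  set p := FormalMultilinearSeries.ofScalars ℂ u with hp
  have hrad : ((1 / 2 : NNReal) : ℝ≥0∞) ≤ p.radius := by
    refine p.le_radius_of_summable ?_
    have h1 := (h0 ⟨1 / 2, by norm_num, by norm_num⟩).summable.norm
    convert h1 using 2 with n
    rw [hp, FormalMultilinearSeries.ofScalars_norm]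
    change ‖u n‖ * _ = ‖u n * _‖
    rw [norm_mul (u n), norm_pow]
    norm_num
  have hpos : 0 < p.radius := lt_of_lt_of_le (by simp) hrad
  have hser := (p.hasFPowerSeriesOnBall hpos).hasFPowerSeriesAt
  have hfreq : ∃ᶠ z in 𝓝[≠] (0 : ℂ), p.sum z = 0 := by
    have ht : Tendsto (fun k : ℕ => (((k + 2 : ℝ)⁻¹ : ℝ) : ℂ)) atTop (𝓝[≠] 0) := by
      refine tendsto_nhdsWithin_iff.2 ⟨?_, Eventually.of_forall fun k => ?_⟩
      · rw [← Complex.ofReal_zero]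
        refine (Complex.continuous_ofReal.tendsto 0).comp ?_
        exact tendsto_inv_atTop_zero.comp
          (tendsto_natCast_atTop_atTop.atTop_add tendsto_const_nhds)
      · have : (k + 2 : ℝ) ≠ 0 := by positivity
        simp only [mem_compl_iff, mem_singleton_iff, Complex.ofReal_eq_zero]
        exact inv_ne_zero this
    refine ht.frequently (Frequently.of_forall fun k => ?_)
    have hk : (k + 2 : ℝ)⁻¹ < 1 := inv_lt_one_of_one_lt₀ (by linarith [k.cast_nonneg (α := ℝ)])
    have h1 := h0 ⟨1 - (k + 2 : ℝ)⁻¹, by linarith, by simp; positivity⟩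
    simp only [sub_sub_cancel] at h1
    exact (FormalMultilinearSeries.ofScalars_sum_eq (E := ℂ) u _).trans h1.tsum_eq
  have hev := hser.analyticAt.frequently_zero_iff_eventually_zero.1 hfreq
  have hzero := hser.eq_zero_of_eventually hev
  rw [hp, FormalMultilinearSeries.ofScalars_series_eq_zero] at hzero
  refine lp.ext (funext fun n => ?_)
  have h1 : (((n + 1 : ℝ) ^ δ : ℝ) : ℂ) * v n = 0 := congrFun hzero n
  refine (mul_eq_zero.1 h1).resolve_left ?_
  have : (n + 1 : ℝ) ^ δ ≠ 0 := by positivity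
  exact_mod_cast this

/-! ### The kernel functions in `H²(μ)` -/

theorem memlp_rpow_mul_newtonPoly {δ : ℝ} {z : ℂ} (hz : -(1 / 2 : ℝ) ≤ z.re)
    (hδ : δ < z.re + 1 / 2) :
    Memℓp (fun n : ℕ => (((n + 1 : ℝ) ^ δ : ℝ) : ℂ) * conj (newtonPoly n z)) 2 := by
  obtain ⟨C, hC, hCb⟩ := exists_norm_newtonPoly_le ‖z‖
  refine memlp_two_of_summable (Summable.of_nonneg_of_le (fun n => by positivity) (fun n => ?_)
    ((summable_add_one_rpow (p := 2 * (δ - (z.re + 1))) (by linarith)).mul_left (C ^ 2)))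
  have hp : (0 : ℝ) < n + 1 := by positivity
  have h1 : ‖(((n + 1 : ℝ) ^ δ : ℝ) : ℂ) * conj (newtonPoly n z)‖ ≤
      C * (n + 1 : ℝ) ^ (δ - (z.re + 1)) := by
    rw [norm_mul, RCLike.norm_conj, Complex.norm_real, Real.norm_of_nonneg (by positivity),
      sub_eq_add_neg, Real.rpow_add hp, mul_left_comm]
    exact mul_le_mul_of_nonneg_left (hCb z hz le_rfl n) (by positivity)
  refine (pow_le_pow_left₀ (norm_nonneg _) h1 2).trans_eq ?_
  rw [mul_pow, ← Real.rpow_mul_natCast hp.le, mul_comm (δ - (z.re + 1))]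
  norm_num

/-- The sequence `(n + 1) ^ δ * conj (N_n(z))` in `ℓ²`. Pairing with it, for negative `δ`, is
evaluation at the point `z`, which may lie on the boundary of the half-plane. -/
noncomputable def newtonSeq {δ : ℝ} {z : ℂ} (hz : -(1 / 2 : ℝ) ≤ z.re) (hδ : δ < z.re + 1 / 2) :
    lp (fun _ : ℕ => ℂ) 2 :=
  ⟨_, memlp_rpow_mul_newtonPoly hz hδ⟩

theorem newtonSeq_apply {δ : ℝ} {z : ℂ} (hz : -(1 / 2 : ℝ) ≤ z.re) (hδ : δ < z.re + 1 / 2)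
    (n : ℕ) : newtonSeq hz hδ n = (((n + 1 : ℝ) ^ δ : ℝ) : ℂ) * conj (newtonPoly n z) := rfl

theorem ofReal_rpow_mul_rpow {δ ε : ℝ} (h0 : δ + ε = 0) (n : ℕ) :
    (((n + 1 : ℝ) ^ δ : ℝ) : ℂ) * (((n + 1 : ℝ) ^ ε : ℝ) : ℂ) = 1 := by
  rw [← Complex.ofReal_mul, ← Real.rpow_add (by positivity), h0, Real.rpow_zero,
    Complex.ofReal_one]

theorem inner_newtonSeq_geomSeq {δ ε : ℝ} {z : ℂ} (hz : -(1 / 2 : ℝ) ≤ z.re)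
    (hδ : δ < z.re + 1 / 2) (hε : ε ≤ 1 / 2) (h0 : δ + ε = 0) (a : Ioc (0 : ℝ) 1) :
    inner ℂ (newtonSeq hz hδ) (geomSeq hε a) = ((a : ℝ) : ℂ) ^ z := by
  refine (lp.hasSum_inner _ _).unique ?_
  have h : ∀ n : ℕ, inner ℂ (newtonSeq hz hδ n) (geomSeq hε a n) =
      (((1 - a : ℝ) ^ n : ℝ) : ℂ) * newtonPoly n z := by
    intro n
    rw [newtonSeq_apply, geomSeq_apply, RCLike.inner_apply, map_mul, Complex.conj_ofReal,
      Complex.conj_conj, Complex.ofReal_mul]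
    linear_combination (((1 - a : ℝ) ^ n : ℝ) : ℂ) * newtonPoly n z * ofReal_rpow_mul_rpow h0 n
  rw [funext h]
  exact hasSum_pow_mul_newtonPoly a.2 z

theorem inner_newtonSeq_newtonSeq {δ ε : ℝ} {z w : ℂ} (hz : -(1 / 2 : ℝ) ≤ z.re)
    (hδ : δ < z.re + 1 / 2) (hw : -(1 / 2 : ℝ) ≤ w.re) (hε : ε < w.re + 1 / 2) (h0 : δ + ε = 0) :
    inner ℂ (newtonSeq hz hδ) (newtonSeq hw hε) = kernelSeries w z := by
  rw [← (lp.hasSum_inner _ _).tsum_eq, kernelSeries]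
  refine tsum_congr fun n => ?_
  rw [newtonSeq_apply, newtonSeq_apply, RCLike.inner_apply, map_mul, Complex.conj_ofReal,
    Complex.conj_conj]
  linear_combination conj (newtonPoly n w) * newtonPoly n z * ofReal_rpow_mul_rpow h0 n

theorem inner_linearCombination_congr {ι E F : Type*} [NormedAddCommGroup E]
    [InnerProductSpace ℂ E] [NormedAddCommGroup F] [InnerProductSpace ℂ F] {u : ι → E} {v : ι → F}
    {x : E} {y : F} (h : ∀ i, inner ℂ x (u i) = inner ℂ y (v i)) (c : ι →₀ ℂ) :
    inner ℂ x (Finsupp.linearCombination ℂ u c) = inner ℂ y (Finsupp.linearCombination ℂ v c) := by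
  simp only [Finsupp.linearCombination_apply, Finsupp.sum, inner_sum, inner_smul_right, h]

/-- Families with the same Gram matrix have linear combinations of the same norm. -/
theorem norm_linearCombination_congr {ι E F : Type*} [NormedAddCommGroup E]
    [InnerProductSpace ℂ E] [NormedAddCommGroup F] [InnerProductSpace ℂ F] {u : ι → E} {v : ι → F}
    (h : ∀ i j, inner ℂ (u i) (u j) = inner ℂ (v i) (v j)) (c : ι →₀ ℂ) :
    ‖Finsupp.linearCombination ℂ u c‖ = ‖Finsupp.linearCombination ℂ v c‖ := by
  have h1 : ∀ i, inner ℂ (Finsupp.linearCombination ℂ u c) (u i) =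
      inner ℂ (Finsupp.linearCombination ℂ v c) (v i) := by
    intro i
    rw [← inner_conj_symm, inner_linearCombination_congr (h i), inner_conj_symm]
  rw [norm_eq_sqrt_re_inner (𝕜 := ℂ), norm_eq_sqrt_re_inner (𝕜 := ℂ),
    inner_linearCombination_congr h1]

theorem lp_two_norm_mono {f g : lp (fun _ : ℕ => ℂ) 2} (h : ∀ n, ‖f n‖ ≤ ‖g n‖) : ‖f‖ ≤ ‖g‖ := by
  have h2 : 0 < (2 : ℝ≥0∞).toReal := by norm_num
  refine lp.norm_le_of_tsum_le h2 (norm_nonneg _) ?_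
  rw [lp.norm_rpow_eq_tsum h2]
  exact ((lp.memℓp f).summable h2).tsum_le_tsum
    (fun n => Real.rpow_le_rpow (norm_nonneg _) (h n) h2.le) ((lp.memℓp g).summable h2)

theorem linearCombination_geomSeq_apply {δ : ℝ} (hδ : δ ≤ 1 / 2) (c : Ioc (0 : ℝ) 1 →₀ ℂ) (n : ℕ) :
    Finsupp.linearCombination ℂ (geomSeq hδ) c n = (((n + 1 : ℝ) ^ δ : ℝ) : ℂ) *
      Finsupp.linearCombination ℂ (geomSeq (δ := 0) (by norm_num)) c n := by
  induction c using Finsupp.induction_linear with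
  | zero => simp
  | add c d hc hd => simp only [map_add, lp.coeFn_add, Pi.add_apply, hc, hd, mul_add]
  | single a b =>
    simp only [Finsupp.linearCombination_single, lp.coeFn_smul, Pi.smul_apply, geomSeq_apply,
      smul_eq_mul, Real.rpow_zero, one_mul, Complex.ofReal_mul]
    ring

theorem norm_linearCombination_powH2_le {δ : ℝ} (hδ0 : 0 ≤ δ) (hδ : δ ≤ 1 / 2)
    (c : Ioc (0 : ℝ) 1 →₀ ℂ) :
    ‖Finsupp.linearCombination ℂ powH2 c‖ ≤ ‖Finsupp.linearCombination ℂ (geomSeq hδ) c‖ := by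
  have h0 : (0 : ℝ) ≤ 1 / 2 := by norm_num
  rw [norm_linearCombination_congr (v := geomSeq h0) fun a b => by
    rw [inner_powH2, inner_geomSeq h0 h0 (add_zero 0)]]
  refine lp_two_norm_mono fun n => ?_
  rw [linearCombination_geomSeq_apply hδ, norm_mul, Complex.norm_real,
    Real.norm_of_nonneg (by positivity)]
  exact le_mul_of_one_le_left (norm_nonneg _) (Real.one_le_rpow (by simp) hδ0)

theorem coeFn_linearCombination_powH2 (c : Ioc (0 : ℝ) 1 →₀ ℂ) :
    ((Finsupp.linearCombination ℂ powH2 c : H2) : Lp ℂ 2 mu) =ᵐ[mu]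
      fun z => Finsupp.linearCombination ℂ (fun a : Ioc (0 : ℝ) 1 => ((a : ℝ) : ℂ) ^ z) c := by
  induction c using Finsupp.induction_linear with
  | zero =>
    simp only [map_zero, Submodule.coe_zero]
    exact Lp.coeFn_zero _ _ _
  | add c d hc hd =>
    simp only [map_add, Submodule.coe_add]
    filter_upwards [hc, hd, Lp.coeFn_add
      ((Finsupp.linearCombination ℂ powH2 c : H2) : Lp ℂ 2 mu)
      (Finsupp.linearCombination ℂ powH2 d : H2)] with z h1 h2 h3
    rw [h3, Pi.add_apply, h1, h2]
  | single a b =>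
    simp only [Finsupp.linearCombination_single, Submodule.coe_smul]
    filter_upwards [coeFn_powH2 a, Lp.coeFn_smul b (powH2 a : Lp ℂ 2 mu)] with z h1 h2
    rw [h2, Pi.smul_apply, h1]

/-- The kernel function `K_w` as an element of `H²(μ)`. It is approximated by linear combinations
of the functions `a ^ z` in a norm with weights `(n + 1) ^ δ`, which is stronger than the norm of
the Newton space and for which evaluation at the boundary points is still continuous. -/
theorem exists_kernel_mem_H2 {w : ℂ} (hw : -(1 / 2 : ℝ) < w.re) :
    ∃ g : H2, (∀ᵐ z ∂mu, (g : Lp ℂ 2 mu) z = kernelSeries w z) ∧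
      (∀ a : Ioc (0 : ℝ) 1, inner ℂ (powH2 a) g = conj (((a : ℝ) : ℂ) ^ w)) ∧
      inner ℂ g g = conj (kernelSeries w w) := by
  obtain ⟨δ, hδ0, hδ, hδw⟩ : ∃ δ : ℝ, 0 < δ ∧ δ ≤ 1 / 2 ∧ δ < w.re + 1 / 2 := by
    obtain ⟨δ, h1, h2⟩ := exists_between (show 0 < min (1 / 2) (w.re + 1 / 2) from
      lt_min (by norm_num) (by linarith))
    exact ⟨δ, h1, (lt_min_iff.1 h2).1.le, (lt_min_iff.1 h2).2⟩
  have hδ' : -δ ≤ 1 / 2 := by linarith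
  have hneg : ∀ {z : ℂ}, -(1 / 2 : ℝ) ≤ z.re → -δ < z.re + 1 / 2 := fun h => by linarith
  set κ := newtonSeq hw.le hδw
  -- approximation in the weighted norm
  have hκ : κ ∈ closure (Submodule.span ℂ (range (geomSeq hδ)) : Set (lp (fun _ : ℕ => ℂ) 2)) := by
    rw [← Submodule.topologicalClosure_coe, span_geomSeq_dense]
    trivial
  obtain ⟨x, hx, hxκ⟩ := mem_closure_iff_seq_limit.1 hκ
  simp only [SetLike.mem_coe, Finsupp.mem_span_range_iff_exists_finsupp] at hx
  choose c hc using hx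
  have hcx : ∀ j, Finsupp.linearCombination ℂ (geomSeq hδ) (c j) = x j := hc
  have heval : ∀ z : ℂ, -(1 / 2 : ℝ) ≤ z.re → Tendsto (fun j =>
      Finsupp.linearCombination ℂ (fun a : Ioc (0 : ℝ) 1 => ((a : ℝ) : ℂ) ^ z) (c j)) atTop
      (𝓝 (kernelSeries w z)) := by
    intro z hz
    have h1 := (tendsto_const_nhds (x := newtonSeq hz (hneg hz))).inner (𝕜 := ℂ) hxκ
    rw [inner_newtonSeq_newtonSeq hz (hneg hz) hw.le hδw (neg_add_cancel δ)] at h1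
    refine h1.congr fun j => ?_
    rw [← hcx]
    simp only [Finsupp.linearCombination_apply, Finsupp.sum, inner_sum, inner_smul_right,
      inner_newtonSeq_geomSeq hz (hneg hz) hδ (neg_add_cancel δ), smul_eq_mul]
  -- the same linear combinations converge in `H²(μ)`
  have hcauchy : CauchySeq fun j => Finsupp.linearCombination ℂ powH2 (c j) := by
    rw [Metric.cauchySeq_iff]
    intro ε hε
    obtain ⟨N, hN⟩ := Metric.cauchySeq_iff.1 hxκ.cauchySeq ε hε
    refine ⟨N, fun m hm n hn => lt_of_le_of_lt ?_ (hN m hm n hn)⟩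
    rw [dist_eq_norm, dist_eq_norm, ← map_sub, ← hcx, ← hcx, ← map_sub]
    exact norm_linearCombination_powH2_le hδ0.le hδ _
  obtain ⟨g, hg⟩ := cauchySeq_tendsto_of_complete hcauchy
  have hinner : ∀ a : Ioc (0 : ℝ) 1, inner ℂ (powH2 a) g = conj (((a : ℝ) : ℂ) ^ w) := by
    intro a
    have h1 := (tendsto_const_nhds (x := powH2 a)).inner (𝕜 := ℂ) hg
    have h2 := (tendsto_const_nhds (x := geomSeq hδ' a)).inner (𝕜 := ℂ) hxκ
    rw [← inner_newtonSeq_geomSeq hw.le hδw hδ' (add_neg_cancel δ), inner_conj_symm]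
    refine tendsto_nhds_unique (h1.congr fun j => ?_) h2
    rw [← hcx]
    refine inner_linearCombination_congr (fun b => ?_) _
    rw [inner_powH2, inner_geomSeq hδ' hδ (neg_add_cancel δ)]
  refine ⟨g, ?_, hinner, ?_⟩
  · have hgL : Tendsto (fun j => ((Finsupp.linearCombination ℂ powH2 (c j) : H2) : Lp ℂ 2 mu))
        atTop (𝓝 (g : Lp ℂ 2 mu)) := (continuous_subtype_val.tendsto g).comp hg
    obtain ⟨ns, hns, hae⟩ := (tendstoInMeasure_of_tendsto_Lp hgL).exists_seq_tendsto_ae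
    filter_upwards [hae, ae_mu_re,
      ae_all_iff.2 fun j => coeFn_linearCombination_powH2 (c j)] with z h1 h2 h3
    refine tendsto_nhds_unique h1 ?_
    simp_rw [h3]
    exact (heval z h2).comp hns.tendsto_atTop
  · have h1 := hg.inner (𝕜 := ℂ) (tendsto_const_nhds (x := g))
    refine tendsto_nhds_unique h1 ?_
    refine ((Complex.continuous_conj.tendsto _).comp (heval w hw.le)).congr fun j => ?_
    simp only [Function.comp_apply, Finsupp.linearCombination_apply, Finsupp.sum, sum_inner,
      inner_smul_left, hinner, map_sum, map_mul, smul_eq_mul]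

/-! ### Boundary values -/

theorem coeff_kernelFun (w : HalfPlane) (n : ℕ) :
    (kernelFun w).coeff n = conj (newtonPoly n w) := by
  have h : kernelFun w = conjNewton w := ext_inner_right ℂ fun f => by
    rw [inner_kernelFun, NewtonSpace.apply_eq_eval, eval_eq_inner]
  rw [h]
  rfl

theorem kernelFun_apply (w z : HalfPlane) : kernelFun w z = kernelSeries w z := by
  rw [NewtonSpace.apply_eq_eval, NewtonSpace.eval, kernelSeries]
  simp_rw [coeff_kernelFun]

theorem kernelSeries_self (w : HalfPlane) :
    kernelSeries w w = ((‖kernelFun w‖ ^ 2 : ℝ) : ℂ) := by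
  rw [← kernelFun_apply, ← inner_kernelFun, inner_self_eq_norm_sq_to_K]
  norm_cast

theorem norm_kernelFun_ne_zero (w : HalfPlane) : ‖kernelFun w‖ ≠ 0 := by
  rw [norm_ne_zero_iff]
  intro h
  have h0 := coeff_kernelFun w 0
  rw [h] at h0
  have h1 : (0 : NewtonSpace).coeff 0 = 0 := rfl
  rw [h1] at h0
  simp [newtonPoly] at h0

theorem normalizedKernel_apply (w z : HalfPlane) :
    normalizedKernel w z = ((‖kernelFun w‖⁻¹ : ℝ) : ℂ) * kernelSeries w z := by
  rw [← inner_kernelFun z, normalizedKernel, inner_smul_right, inner_kernelFun, kernelFun_apply]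

theorem represents_normalizedKernel (w : HalfPlane) {g : Lp ℂ 2 mu}
    (hg : ∀ᵐ z ∂mu, g z = ((‖kernelFun w‖⁻¹ : ℝ) : ℂ) * kernelSeries w z) :
    Represents g (normalizedKernel w) := by
  filter_upwards [hg] with z hz
  refine ⟨fun hre => by rw [hz, normalizedKernel_apply], fun hre C => ?_⟩
  rw [hz, funext (normalizedKernel_apply w)]
  refine Tendsto.mono_left ?_ inf_le_left
  have h1 : Tendsto (fun z => ((‖kernelFun w‖⁻¹ : ℝ) : ℂ) * kernelSeries w z)
      (𝓝[{z : ℂ | -(1 / 2 : ℝ) ≤ z.re}] z)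
      (𝓝 (((‖kernelFun w‖⁻¹ : ℝ) : ℂ) * kernelSeries w z)) :=
    (continuousOn_kernelSeries w.2 z hre.ge).const_mul _
  have h2 : Tendsto (fun z : HalfPlane => (z : ℂ)) (comap (fun z : HalfPlane => (z : ℂ)) (𝓝 z))
      (𝓝[{z : ℂ | -(1 / 2 : ℝ) ≤ z.re}] z) :=
    tendsto_nhdsWithin_iff.2 ⟨tendsto_comap, Eventually.of_forall fun z => z.2.le⟩
  exact h1.comp h2

/-- A nontangential limit is unique, since every boundary point is a limit of points of the sector
`|z - z₀| < 2 (Re z + 1/2)`. -/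
theorem HasNontangentialLimit.unique {f : HalfPlane → ℂ} {z₀ l l' : ℂ} (hz₀ : z₀.re = -(1 / 2 : ℝ))
    (h : HasNontangentialLimit f z₀ l) (h' : HasNontangentialLimit f z₀ l') : l = l' := by
  have hre : ∀ k : ℕ, -(1 / 2 : ℝ) < (z₀ + ((1 / (k + 1 : ℝ) : ℝ) : ℂ)).re := by
    intro k
    rw [Complex.add_re, Complex.ofReal_re, hz₀]
    have : (0 : ℝ) < 1 / (k + 1) := by positivity
    linarith
  have ht : Tendsto (fun k : ℕ => (⟨z₀ + ((1 / (k + 1 : ℝ) : ℝ) : ℂ), hre k⟩ : HalfPlane)) atTop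
      (comap (fun z : HalfPlane => (z : ℂ)) (𝓝 z₀) ⊓
        𝓟 {z : HalfPlane | ‖(z : ℂ) - z₀‖ < 2 * ((z : ℂ).re + 1 / 2)}) := by
    refine tendsto_inf.2 ⟨tendsto_comap_iff.2 ?_, tendsto_principal.2 (Eventually.of_forall ?_)⟩
    · have h0 := (Complex.continuous_ofReal.tendsto 0).comp
        (tendsto_one_div_add_atTop_nhds_zero_nat (𝕜 := ℝ))
      simpa [Function.comp_def] using h0.const_add z₀
    · intro k
      have : (0 : ℝ) < 1 / (k + 1) := by positivity
      rw [mem_ofPred_eq, add_sub_cancel_left, Complex.norm_real, Real.norm_of_nonneg this.le,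
        Complex.add_re, Complex.ofReal_re, hz₀]
      linarith
  exact tendsto_nhds_unique ((h 2).comp ht) ((h' 2).comp ht)

theorem Represents.unique {g g' : Lp ℂ 2 mu} {f : NewtonSpace} (h : Represents g f)
    (h' : Represents g' f) : g = g' := by
  refine Lp.ext ?_
  filter_upwards [h, h', ae_mu_re] with z h1 h2 hre
  rcases hre.lt_or_eq with hlt | heq
  · rw [h1.1 hlt, h2.1 hlt]
  · exact (h1.2 heq.symm).unique heq.symm (h2.2 heq.symm)

/-! ### The operators `T` with symbol `s ^ z` -/

theorem inner_smul_right_H2 (c : ℂ) (x y : H2) : inner ℂ x (c • y) = c * inner ℂ x y :=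
  inner_smul_right x y c

theorem inner_smul_left_H2 (c : ℂ) (x y : H2) : inner ℂ (c • x) y = conj c * inner ℂ x y :=
  inner_smul_left x y c

theorem ext_powH2 {A B : H2 →L[ℂ] H2} (h : ∀ a, A (powH2 a) = B (powH2 a)) : A = B := by
  refine ContinuousLinearMap.adjoint.injective (ContinuousLinearMap.ext fun y => ?_)
  refine ext_inner_powH2 fun a => ?_
  rw [ContinuousLinearMap.adjoint_inner_right, ContinuousLinearMap.adjoint_inner_right, h]

/-- The product of two numbers of `(0, 1]`. -/
def mulIoc (s : ℝ) (hs : s ∈ Ioo (0 : ℝ) 1) (a : Ioc (0 : ℝ) 1) : Ioc (0 : ℝ) 1 :=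
  ⟨s * a, mul_pos hs.1 a.2.1, mul_le_one₀ hs.2.le a.2.1.le a.2.2⟩

theorem toeplitz_powH2 (s : ℝ) (hs : s ∈ Ioo (0 : ℝ) 1) (a : Ioc (0 : ℝ) 1) :
    toeplitz (powSymbol s hs) (powH2 a) = powH2 (mulIoc s hs a) := by
  have h : mulOp (powSymbol s hs) (powH2 a) = (powH2 (mulIoc s hs a) : Lp ℂ 2 mu) := by
    refine Lp.ext ?_
    have h1 := (ContinuousLinearMap.mul ℂ ℂ).coeFn_holder (r := 2) (powSymbol s hs)
      (powH2 a : Lp ℂ 2 mu)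
    filter_upwards [h1, coeFn_powH2 a, coeFn_powH2 (mulIoc s hs a),
      (memLp_top_cpow hs).coeFn_toLp] with z h2 h3 h4 h5
    rw [h4]
    refine h2.trans ?_
    rw [ContinuousLinearMap.mul_apply', h3, powSymbol, h5, mulIoc]
    push_cast
    rw [Complex.mul_cpow_ofReal_nonneg hs.1.le a.2.1.le]
  rw [toeplitz, ContinuousLinearMap.comp_apply, ContinuousLinearMap.comp_apply,
    Submodule.subtypeL_apply, h, Submodule.orthogonalProjectionOnto_mem_subspace_eq_self]

theorem add_sub_mul_pos {a c : ℝ} (ha : a ∈ Ioc (0 : ℝ) 1) (hc : c ∈ Ioc (0 : ℝ) 1) :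
    0 < a + c - a * c := by
  have h1 : 0 ≤ c * (1 - a) := mul_nonneg hc.1.le (by linarith [ha.2])
  nlinarith [ha.1]

/-- The parameter `a / (a + c - a c)` of `T_{c^z}^* a^z`. -/
noncomputable def adjointParam (c : ℝ) (hc : c ∈ Ioo (0 : ℝ) 1) (a : Ioc (0 : ℝ) 1) :
    Ioc (0 : ℝ) 1 :=
  ⟨a / (a + c - a * c), by
    have h1 := add_sub_mul_pos a.2 ⟨hc.1, hc.2.le⟩
    refine ⟨div_pos a.2.1 h1, ?_⟩
    rw [div_le_one h1]
    nlinarith [mul_nonneg hc.1.le (sub_nonneg.2 a.2.2)]⟩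

/-- `T_{c^z}^* a^z = (a + c - a c)⁻¹ (a / (a + c - a c))^z`, because both sides have inner product
`(a + c b - a c b)⁻¹` with `b^z`. -/
theorem adjoint_toeplitz_powH2 (c : ℝ) (hc : c ∈ Ioo (0 : ℝ) 1) (a : Ioc (0 : ℝ) 1) :
    ContinuousLinearMap.adjoint (toeplitz (powSymbol c hc)) (powH2 a) =
      (((a + c - a * c : ℝ)⁻¹ : ℝ) : ℂ) • powH2 (adjointParam c hc a) := by
  refine ext_inner_powH2 fun b => ?_
  rw [ContinuousLinearMap.adjoint_inner_right, toeplitz_powH2, inner_smul_right_H2, inner_powH2,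
    inner_powH2, ← Complex.ofReal_mul, ← mul_inv]
  have h := (add_sub_mul_pos a.2 ⟨hc.1, hc.2.le⟩).ne'
  congr 2
  have hq : (a + c - a * c : ℝ) * (a / (a + c - a * c)) = a := mul_div_cancel₀ _ h
  simp only [mulIoc, adjointParam]
  linear_combination ((b : ℝ) - 1) * hq

/-- The numbers `s / (s + t - s t)` lie in `(0, 1)`. -/
theorem div_add_sub_mul_mem {s t : ℝ} (hs : s ∈ Ioo (0 : ℝ) 1) (ht : t ∈ Ioo (0 : ℝ) 1) :
    s / (s + t - s * t) ∈ Ioo (0 : ℝ) 1 := by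
  have h := add_sub_mul_pos ⟨hs.1, hs.2.le⟩ ⟨ht.1, ht.2.le⟩
  refine ⟨div_pos hs.1 h, ?_⟩
  rw [div_lt_one h]
  nlinarith [mul_pos ht.1 (sub_pos.2 hs.2)]

theorem div_add_sub_mul_mem' {s t : ℝ} (hs : s ∈ Ioo (0 : ℝ) 1) (ht : t ∈ Ioo (0 : ℝ) 1) :
    t / (s + t - s * t) ∈ Ioo (0 : ℝ) 1 := by
  have h := div_add_sub_mul_mem ht hs
  rwa [add_comm, mul_comm] at h

/-- The commutation relation `T_{t^z}^* T_{s^z} = D⁻¹ T_{(s/D)^z} T_{(t/D)^z}^*` with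
`D = s + t - s t`. It moves the adjoints to the side where they act on the kernel functions. -/
theorem adjoint_toeplitz_comp_toeplitz {s t : ℝ} (hs : s ∈ Ioo (0 : ℝ) 1)
    (ht : t ∈ Ioo (0 : ℝ) 1) :
    ContinuousLinearMap.adjoint (toeplitz (powSymbol t ht)) ∘L toeplitz (powSymbol s hs) =
      (((s + t - s * t)⁻¹ : ℝ) : ℂ) •
        (toeplitz (powSymbol _ (div_add_sub_mul_mem hs ht)) ∘L
          ContinuousLinearMap.adjoint
            (toeplitz (powSymbol _ (div_add_sub_mul_mem' hs ht)))) := by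
  refine ext_powH2 fun a => ext_inner_powH2 fun b => ?_
  have hD := add_sub_mul_pos ⟨hs.1, hs.2.le⟩ ⟨ht.1, ht.2.le⟩
  have hc := div_add_sub_mul_mem' hs ht
  have h1 := add_sub_mul_pos a.2 ⟨hc.1, hc.2.le⟩
  rw [smul_apply, inner_smul_right_H2, ContinuousLinearMap.comp_apply,
    ContinuousLinearMap.comp_apply, ContinuousLinearMap.adjoint_inner_right,
    adjoint_toeplitz_powH2, map_smul, inner_smul_right_H2]
  simp only [toeplitz_powH2, inner_powH2]
  rw [← Complex.ofReal_mul, ← Complex.ofReal_mul, ← mul_inv, ← mul_inv]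
  congr 2
  simp only [mulIoc, adjointParam]
  -- `E` is the denominator in `T_{(t/D)^z}^* a^z = E⁻¹ q^z`, and `r = s / D`
  have key : ∀ D E q r : ℝ, D = s + t - s * t → D * E = a * D + t - a * t → D * r = s → E * q = a →
      t * b + s * a - t * b * (s * a) = D * (E * (b + r * q - b * (r * q))) := by
    intro D E q r hD hE hr hq
    linear_combination -(b : ℝ) * hE - (1 - b) * (E * q * hr + s * hq) - (a * b : ℝ) * hD
  refine key _ _ _ _ rfl ?_ (mul_div_cancel₀ _ hD.ne') (mul_div_cancel₀ _ h1.ne')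
  have := mul_div_cancel₀ t hD.ne'
  linear_combination (1 - a : ℝ) * this

/-- `T_{c^z}^* k = conj (c ^ w) k` for `k` a multiple of the kernel function at `w`. -/
theorem adjoint_toeplitz_kernel {w : ℂ} {g : H2}
    (hg : ∀ a : Ioc (0 : ℝ) 1, inner ℂ (powH2 a) g = conj (((a : ℝ) : ℂ) ^ w))
    (c : ℝ) (hc : c ∈ Ioo (0 : ℝ) 1) :
    ContinuousLinearMap.adjoint (toeplitz (powSymbol c hc)) g = conj ((c : ℂ) ^ w) • g := by
  refine ext_inner_powH2 fun b => ?_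
  rw [ContinuousLinearMap.adjoint_inner_right, toeplitz_powH2, inner_smul_right_H2, hg, hg, mulIoc]
  push_cast
  rw [Complex.mul_cpow_ofReal_nonneg hc.1.le b.2.1.le, map_mul]

theorem inner_adjoint_toeplitz_comp_toeplitz_kernel {w : ℂ} {g : H2}
    (hg : ∀ a : Ioc (0 : ℝ) 1, inner ℂ (powH2 a) g = conj (((a : ℝ) : ℂ) ^ w))
    {s t : ℝ} (hs : s ∈ Ioo (0 : ℝ) 1) (ht : t ∈ Ioo (0 : ℝ) 1) :
    inner ℂ g ((ContinuousLinearMap.adjoint (toeplitz (powSymbol t ht)) ∘L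
      toeplitz (powSymbol s hs)) g) =
      (s : ℂ) ^ w * (t : ℂ) ^ (conj w) / (((s + t - s * t) ^ (2 * w.re + 1) : ℝ) : ℂ) *
        inner ℂ g g := by
  have hD := add_sub_mul_pos ⟨hs.1, hs.2.le⟩ ⟨ht.1, ht.2.le⟩
  have hD0 : ((s + t - s * t : ℝ) : ℂ) ≠ 0 := by exact_mod_cast hD.ne'
  rw [adjoint_toeplitz_comp_toeplitz hs ht, smul_apply, inner_smul_right_H2,
    ContinuousLinearMap.comp_apply, ← ContinuousLinearMap.adjoint_inner_left,
    adjoint_toeplitz_kernel hg, adjoint_toeplitz_kernel hg, inner_smul_left_H2, inner_smul_right_H2,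
    Complex.conj_conj, conj_ofReal_cpow (div_add_sub_mul_mem' hs ht).1]
  have hdiv : ∀ {x : ℝ} (_ : 0 ≤ x) (v : ℂ), ((x / (s + t - s * t) : ℝ) : ℂ) ^ v =
      (x : ℂ) ^ v / ((s + t - s * t : ℝ) : ℂ) ^ v := by
    intro x hx v
    rw [div_eq_mul_inv, Complex.ofReal_mul, Complex.mul_cpow_ofReal_nonneg hx (inv_nonneg.2 hD.le),
      Complex.ofReal_inv, Complex.inv_cpow _ _ (by
        rw [Complex.arg_ofReal_of_nonneg hD.le]; exact Real.pi_pos.ne), ← div_eq_mul_inv]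
  have hpow : (((s + t - s * t) ^ (2 * w.re + 1) : ℝ) : ℂ) =
      ((s + t - s * t : ℝ) : ℂ) ^ w * ((s + t - s * t : ℝ) : ℂ) ^ (conj w) *
        ((s + t - s * t : ℝ) : ℂ) := by
    have h1 : ((2 * w.re + 1 : ℝ) : ℂ) = w + conj w + 1 := by
      rw [Complex.add_conj]
      push_cast
      ring
    rw [Complex.ofReal_cpow hD.le, h1, Complex.cpow_add _ _ hD0, Complex.cpow_add _ _ hD0,
      Complex.cpow_one]
  rw [hdiv hs.1.le, hdiv ht.1.le, hpow, Complex.ofReal_inv]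
  have h1 : ((s + t - s * t : ℝ) : ℂ) ^ w ≠ 0 := fun h =>
    hD0 (Complex.cpow_eq_zero_iff _ _ |>.1 h).1
  have h2 : ((s + t - s * t : ℝ) : ℂ) ^ (conj w) ≠ 0 := fun h =>
    hD0 (Complex.cpow_eq_zero_iff _ _ |>.1 h).1
  field_simp

end Newton

theorem mainTheorem10 (s t : ℝ) (hs : s ∈ Set.Ioo (0 : ℝ) 1) (ht : t ∈ Set.Ioo (0 : ℝ) 1)
    (w : ℂ) (hw : -(1 / 2 : ℝ) < w.re) :
    (∃! k : Newton.H2, Newton.Represents (k : Lp ℂ 2 Newton.mu)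
      (Newton.normalizedKernel ⟨w, hw⟩)) ∧
    ∀ k : Newton.H2, Newton.Represents (k : Lp ℂ 2 Newton.mu)
      (Newton.normalizedKernel ⟨w, hw⟩) →
      inner ℂ k
        ((ContinuousLinearMap.adjoint (Newton.toeplitz (Newton.powSymbol t ht)) ∘L
          Newton.toeplitz (Newton.powSymbol s hs)) k) =
        (s : ℂ) ^ w * (t : ℂ) ^ (conj w) /
          (((s + t - s * t) ^ (2 * w.re + 1) : ℝ) : ℂ) := by
  obtain ⟨g, hg, hinner, hself⟩ := Newton.exists_kernel_mem_H2 hw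
  set W : Newton.HalfPlane := ⟨w, hw⟩ with hW
  set N : ℝ := ‖Newton.kernelFun W‖ with hN
  have hN0 : (N : ℂ) ≠ 0 := by exact_mod_cast Newton.norm_kernelFun_ne_zero W
  have hself' : inner ℂ g g = (N : ℂ) ^ 2 := by
    have h1 := Newton.kernelSeries_self W
    rw [hself, h1, Complex.conj_ofReal, Complex.ofReal_pow]
  have hrep : Newton.Represents ((((N⁻¹ : ℝ) : ℂ) • g : Newton.H2) : Lp ℂ 2 Newton.mu)
      (Newton.normalizedKernel W) := by
    refine Newton.represents_normalizedKernel W ?_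
    rw [Submodule.coe_smul]
    filter_upwards [hg, Lp.coeFn_smul ((N⁻¹ : ℝ) : ℂ) (g : Lp ℂ 2 Newton.mu)] with z h1 h2
    rw [h2, Pi.smul_apply, h1, smul_eq_mul]
  refine ⟨⟨_, hrep, fun k hk => Subtype.ext (hk.unique hrep)⟩, fun k hk => ?_⟩
  rw [show k = ((N⁻¹ : ℝ) : ℂ) • g from Subtype.ext (hk.unique hrep), map_smul,
    Newton.inner_smul_left_H2, Newton.inner_smul_right_H2,
    Newton.inner_adjoint_toeplitz_comp_toeplitz_kernel hinner, hself',
    Complex.conj_ofReal, Complex.ofReal_inv]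
  field_simp
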